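/- Let $\mathcal A$ be a commutative $\mathbb C$-algebra and $\mathcal C=\mathcal A[[t_1,t_2,\dots]]$ the ring of formal power series in infinitely many variables. Write $\mathbb Z\times\mathbb Z$ matrices over $\mathcal C$ as $A=\sum_{j\le N}a_j(s)\Lambda^j$ for some $N$, where $\Lambda=(\delta_{\mu+1,\nu})_{\mu,\nu\in\mathbb Z}$ and $a_j(s)\in\mathcal C$ stands for the diagonal matrix with $s$-th diagonal entry $a_j(s)$; put $A_+=\sum_{j\ge0}a_j(s)\Lambda^j$, and let $\partial/\partial t_n$ act entrywise. Let $\{B_n\}_{n\ge1}$ be matrices of the form $B_n=\sum_{j=0}^n b^{(n)}_j(s)\Lambda^j$ with $b^{(n)}_n(s)=1$ that satisfy the Zakharov–Shabat equations $$\frac{\partial B_m}{\partial t_n}-\frac{\partial B_n}{\partial t_m}+[B_m,B_n]=0,\qquad m,n=1,2,\dots$$ Then there exists a matrix $$L=\Lambda+u_0(s)+u_{-1}(s)\Lambda^{-1}+\cdots\quad\text{such that}\quad \frac{\partial L}{\partial t_n}=[B_n,L],\qquad n=1,2,\dots$$ Moreover, for every such $L$ there are an invertible formal change of variables $t\mapsto\tilde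 t$, where $\tilde t_n-t_n$ is a power series without constant term in $t_{n+1},t_{n+2},\dots$ only and the inverse change is of the same form, and a series $f_0\in\mathcal C$, such that: 1. $\dfrac{\partial L}{\partial\tilde t_n}=[(L^n)_+,L]$ for all $n\ge1$; that is, $L$, rewritten as a function of $\tilde t$, is a Lax operator of the matrix mKP hierarchy with times $\tilde t_1,\tilde t_2,\dots$; 2. $\displaystyle B_n=\sum_{k=1}^n\frac{\partial\tilde t_k}{\partial t_n}(L^k)_+ +\frac{\partial f_0}{\partial t_n}$ for all $n\ge1$ (the last term times the identity matrix). -/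

import Mathlib

/-- The `ℤ × ℤ` matrices `∑_{k ≤ N} a_k(s) Λ^k` (some `N`): all entries more than `N` steps above
the main diagonal vanish. -/
def bandSubmodule (R : Type*) [CommRing R] : Submodule R (Matrix ℤ ℤ R) where
  carrier := {A | ∃ N : ℤ, ∀ i j : ℤ, i + N < j → A i j = 0}
  zero_mem' := ⟨0, fun _ _ _ => rfl⟩
  add_mem' := by
    rintro A B ⟨N, hN⟩ ⟨M, hM⟩
    refine ⟨max N M, fun i j h => ?_⟩
    have h1 := le_max_left N M
    have h2 := le_max_right N M
    rw [Matrix.add_apply, hN i j (by omega), hM i j (by omega), add_zero]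
  smul_mem' := by
    rintro c A ⟨N, hN⟩
    exact ⟨N, fun i j h => by rw [Matrix.smul_apply, hN i j h, smul_zero]⟩

/-- The type of `ℤ × ℤ` matrices of the form `∑_{k ≤ N} a_k(s) Λ^k`. -/
abbrev BandMat (R : Type*) [CommRing R] : Type _ := bandSubmodule R

namespace BandMat

variable {R S : Type*} [CommRing R] [CommRing S]

theorem ext' {A B : BandMat R} (h : ∀ i j, A.1 i j = B.1 i j) : A = B :=
  Subtype.ext (Matrix.ext h)

/-- The coefficient `a_j(s)` in `A = ∑_j diag_s[a_j(s)] Λ^j`, where `Λ = (δ_{μ+1,ν})`: the entry in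
row `s` on the `j`-th diagonal. -/
def coeff (A : BandMat R) (j s : ℤ) : R := A.1 s (s + j)

theorem mul_entry_eq_sum {A B : Matrix ℤ ℤ R} {N M : ℤ}
    (hA : ∀ i j : ℤ, i + N < j → A i j = 0) (hB : ∀ i j : ℤ, i + M < j → B i j = 0)
    {i j a b : ℤ} (ha : a ≤ j - M) (hb : i + N ≤ b) :
    ∑ᶠ k, A i k * B k j = ∑ k ∈ Finset.Icc a b, A i k * B k j := by
  refine finsum_eq_sum_of_support_subset _ fun k hk => ?_
  rw [Function.mem_support] at hk
  rw [Finset.coe_Icc, Set.mem_Icc]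
  by_contra hcon
  apply hk
  by_cases h : i + N < k
  · rw [hA i k h, zero_mul]
  · rw [hB k j (by omega), mul_zero]

/-- The matrix product; every entry is a finite sum. -/
noncomputable instance : Mul (BandMat R) where
  mul A B := ⟨Matrix.of fun i j => ∑ᶠ k, A.1 i k * B.1 k j, by
    obtain ⟨N, hN⟩ := A.2
    obtain ⟨M, hM⟩ := B.2
    refine ⟨N + M, fun i j h => ?_⟩
    rw [Matrix.of_apply, mul_entry_eq_sum hN hM le_rfl le_rfl, Finset.Icc_eq_empty (by omega), Finset.sum_empty]⟩

theorem mul_entry (A B : BandMat R) (i j : ℤ) :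
    (A * B).1 i j = ∑ᶠ k, A.1 i k * B.1 k j := rfl

/-- The identity matrix. -/
instance : One (BandMat R) where
  one := ⟨1, 0, fun _ _ h => Matrix.one_apply_ne (by omega)⟩

theorem one_entry (i j : ℤ) : (1 : BandMat R).1 i j = if i = j then 1 else 0 := by
  change (1 : Matrix ℤ ℤ R) i j = _
  rw [Matrix.one_apply]

theorem add_entry (A B : BandMat R) (i j : ℤ) : (A + B).1 i j = A.1 i j + B.1 i j := rfl

theorem smul_entry (c : R) (A : BandMat R) (i j : ℤ) : (c • A).1 i j = c * A.1 i j := rfl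

protected theorem mul_assoc (A B C : BandMat R) : A * B * C = A * (B * C) := by
  obtain ⟨N, hN⟩ := A.2
  obtain ⟨M, hM⟩ := B.2
  obtain ⟨P, hP⟩ := C.2
  obtain ⟨NM, hNM⟩ := (A * B).2
  obtain ⟨MP, hMP⟩ := (B * C).2
  refine ext' fun i j => ?_
  rw [mul_entry, mul_entry,
    mul_entry_eq_sum hNM hP (min_le_left (j - P) (j - P)) (le_max_left (i + NM) (i + N + M)),
    mul_entry_eq_sum hN hMP (min_le_left (j - MP) (j - P - M)) (le_max_left (i + N) (i + N))]
  simp only [min_self, max_self]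
  set b := max (i + NM) (i + N + M)
  set a := min (j - MP) (j - P - M)
  have ha : a ≤ j - P - M := min_le_right _ _
  have hb : i + N + M ≤ b := le_max_right _ _
  have h1 : ∀ l ∈ Finset.Icc (j - P) b, (A * B).1 i l * C.1 l j =
      ∑ k ∈ Finset.Icc a (i + N), A.1 i k * B.1 k l * C.1 l j := by
    intro l hl
    rw [Finset.mem_Icc] at hl
    rw [mul_entry, mul_entry_eq_sum hN hM (a := a) (b := i + N) (by omega) le_rfl,
      Finset.sum_mul]
  have h2 : ∀ k ∈ Finset.Icc a (i + N), A.1 i k * (B * C).1 k j =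
      ∑ l ∈ Finset.Icc (j - P) b, A.1 i k * B.1 k l * C.1 l j := by
    intro k hk
    rw [Finset.mem_Icc] at hk
    rw [mul_entry, mul_entry_eq_sum hM hP (a := j - P) (b := b) le_rfl (by omega),
      Finset.mul_sum]
    exact Finset.sum_congr rfl fun l _ => (mul_assoc _ _ _).symm
  rw [Finset.sum_congr rfl h1, Finset.sum_congr rfl h2, Finset.sum_comm]

protected theorem one_mul (A : BandMat R) : 1 * A = A := by
  refine ext' fun i j => ?_
  rw [mul_entry, finsum_eq_single _ i]
  · rw [one_entry, if_pos rfl, _root_.one_mul]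
  · intro k hk
    rw [one_entry, if_neg (Ne.symm hk), zero_mul]

protected theorem mul_one (A : BandMat R) : A * 1 = A := by
  refine ext' fun i j => ?_
  rw [mul_entry, finsum_eq_single _ j]
  · rw [one_entry, if_pos rfl, _root_.mul_one]
  · intro k hk
    rw [one_entry, if_neg hk, mul_zero]

protected theorem left_distrib (A B C : BandMat R) : A * (B + C) = A * B + A * C := by
  obtain ⟨N, hN⟩ := A.2
  obtain ⟨M, hM⟩ := B.2
  obtain ⟨P, hP⟩ := C.2
  obtain ⟨Q, hQ⟩ := (B + C).2
  refine ext' fun i j => ?_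
  have e1 := mul_entry_eq_sum (a := min (j - M) (min (j - P) (j - Q))) hN hM (i := i) (j := j)
    (min_le_left _ _) le_rfl
  have e2 := mul_entry_eq_sum (a := min (j - M) (min (j - P) (j - Q))) hN hP (i := i) (j := j)
    ((min_le_right _ _).trans (min_le_left _ _)) le_rfl
  have e3 := mul_entry_eq_sum (a := min (j - M) (min (j - P) (j - Q))) hN hQ (i := i) (j := j)
    ((min_le_right _ _).trans (min_le_right _ _)) le_rfl
  rw [add_entry, mul_entry, mul_entry, mul_entry, e1, e2, e3, ← Finset.sum_add_distrib]
  exact Finset.sum_congr rfl fun k _ => by rw [add_entry, mul_add]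

protected theorem right_distrib (A B C : BandMat R) : (A + B) * C = A * C + B * C := by
  obtain ⟨N, hN⟩ := A.2
  obtain ⟨M, hM⟩ := B.2
  obtain ⟨P, hP⟩ := C.2
  obtain ⟨Q, hQ⟩ := (A + B).2
  refine ext' fun i j => ?_
  have e1 := mul_entry_eq_sum (b := max (i + N) (max (i + M) (i + Q))) hN hP (i := i) (j := j)
    le_rfl (le_max_left _ _)
  have e2 := mul_entry_eq_sum (b := max (i + N) (max (i + M) (i + Q))) hM hP (i := i) (j := j)
    le_rfl ((le_max_left _ _).trans (le_max_right _ _))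
  have e3 := mul_entry_eq_sum (b := max (i + N) (max (i + M) (i + Q))) hQ hP (i := i) (j := j)
    le_rfl ((le_max_right _ _).trans (le_max_right _ _))
  rw [add_entry, mul_entry, mul_entry, mul_entry, e1, e2, e3, ← Finset.sum_add_distrib]
  exact Finset.sum_congr rfl fun k _ => by rw [add_entry, add_mul]

protected theorem zero_mul (A : BandMat R) : 0 * A = 0 := by
  have h := BandMat.right_distrib 0 0 A
  rw [add_zero] at h
  exact left_eq_add.mp h

protected theorem mul_zero (A : BandMat R) : A * 0 = 0 := by
  have h := BandMat.left_distrib A 0 0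
  rw [add_zero] at h
  exact left_eq_add.mp h

noncomputable instance : Ring (BandMat R) where
  mul_assoc := BandMat.mul_assoc
  one_mul := BandMat.one_mul
  mul_one := BandMat.mul_one
  left_distrib := BandMat.left_distrib
  right_distrib := BandMat.right_distrib
  zero_mul := BandMat.zero_mul
  mul_zero := BandMat.mul_zero
  neg_add_cancel := neg_add_cancel
  sub_eq_add_neg := sub_eq_add_neg
  nsmul := fun n A => n • A
  nsmul_zero := fun A => zero_nsmul A
  nsmul_succ := fun n A => succ_nsmul A n
  zsmul := fun n A => n • A
  zsmul_zero' := fun A => zero_zsmul A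
  zsmul_succ' := SubNegMonoid.zsmul_succ'
  zsmul_neg' := SubNegMonoid.zsmul_neg'

/-- The upper triangular part `A₊ = ∑_{j ≥ 0} a_j(s) Λ^j`. -/
def plus (A : BandMat R) : BandMat R :=
  ⟨Matrix.of fun i j => if i ≤ j then A.1 i j else 0, by
    obtain ⟨N, hN⟩ := A.2
    exact ⟨N, fun i j h => by rw [Matrix.of_apply, hN i j h, ite_self]⟩⟩

/-- Apply an additive map to every entry. -/
def mapEntries (φ : R →+ S) (A : BandMat R) : BandMat S :=
  ⟨Matrix.of fun i j => φ (A.1 i j), by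
    obtain ⟨N, hN⟩ := A.2
    exact ⟨N, fun i j h => by rw [Matrix.of_apply, hN i j h, map_zero]⟩⟩

/-- `A = ∑_{j=0}^n a_j(s) Λ^j` with `a_n(s) = 1`. -/
def IsMonicUpper (n : ℕ) (A : BandMat R) : Prop :=
  (∀ j s : ℤ, j < 0 ∨ (n : ℤ) < j → A.coeff j s = 0) ∧ ∀ s : ℤ, A.coeff n s = 1

/-- `A = ∑_{j ≥ 0} u_{1-j}(s) Λ^{1-j}` with `u_1(s) = 1`. -/
def IsLaxForm (A : BandMat R) : Prop :=
  (∀ j s : ℤ, 1 < j → A.coeff j s = 0) ∧ ∀ s : ℤ, A.coeff 1 s = 1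

end BandMat

/-- The ring `𝒜[[t₁, t₂, …]]` of formal power series in infinitely many times. -/
abbrev TimeSeries (A : Type*) [CommRing A] : Type _ := MvPowerSeries ℕ+ A

section Times

variable {A : Type*} [CommRing A]

/-- `∂/∂t_n` on `𝒜[[t₁, t₂, …]]`. -/
noncomputable def dt (n : ℕ+) : TimeSeries A →+ TimeSeries A :=
  (MvPowerSeries.pderiv A n : TimeSeries A →ₗ[A] TimeSeries A).toAddMonoidHom

/-- `∂/∂t_n` on matrices, entry by entry. -/
noncomputable def matDt (n : ℕ+) : BandMat (TimeSeries A) → BandMat (TimeSeries A) :=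
  BandMat.mapEntries (dt n)

/-- `L` is a Lax operator of the matrix mKP hierarchy: it has the form `Λ + u_0(s) + ⋯` and
`∂L/∂t_n = [(L^n)₊, L]` for all `n ≥ 1`. -/
def IsMKPLax (L : BandMat (TimeSeries A)) : Prop :=
  L.IsLaxForm ∧ ∀ n : ℕ+, matDt n L = ⁅(L ^ (n : ℕ)).plus, L⁆

/-- `τ_n = t_n + O(t_{n+1}, t_{n+2}, …)`: the difference `τ_n - t_n` is a power series without
constant term in the variables `t_{n+1}, t_{n+2}, …` only. -/
def IsTriangular (τ : ℕ+ → TimeSeries A) : Prop :=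
  ∀ (n : ℕ+) (d : ℕ+ →₀ ℕ), MvPowerSeries.coeff d (τ n - MvPowerSeries.X n) ≠ 0 →
    d ≠ 0 ∧ ∀ i ∈ d.support, n < i

theorem IsTriangular.hasSubst {τ : ℕ+ → TimeSeries A} (h : IsTriangular τ) :
    MvPowerSeries.HasSubst τ where
  const_coeff n := by
    have h0 : MvPowerSeries.coeff 0 (τ n - MvPowerSeries.X n) = 0 := by
      by_contra hne
      exact (h n 0 hne).1 rfl
    have h1 : MvPowerSeries.constantCoeff (τ n) = 0 := by
      simpa using h0
    rw [h1]
    exact IsNilpotent.zero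
  coeff_zero d := by
    classical
    by_cases hd : d = 0
    · subst hd
      convert Set.finite_empty (α := ℕ+)
      ext n
      simp only [Set.mem_ofPred_eq, Set.mem_empty_iff_false, iff_false, not_not]
      by_contra hne
      refine (h n 0 ?_).1 rfl
      simpa using hne
    · obtain ⟨i, hi⟩ := Finsupp.support_nonempty_iff.mpr hd
      refine (Set.finite_Iic i).subset fun n hn => ?_
      rw [Set.mem_Iic]
      by_contra hlt
      rw [not_le] at hlt
      apply hn
      have h1 : MvPowerSeries.coeff d (MvPowerSeries.X n : TimeSeries A) = 0 := by
        rw [MvPowerSeries.coeff_X, if_neg]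
        rintro rfl
        rw [Finsupp.mem_support_iff, Finsupp.single_apply] at hi
        exact hi (if_neg hlt.ne')
      by_contra hne
      have h2 := (h n d (by rwa [map_sub, h1, sub_zero])).2 i hi
      exact absurd h2 (not_lt.mpr hlt.le)

/-- A triangular formal change of the time variables: `new n` is `t̃_n` as a power series in `t`,
`old n` is `t_n` as a power series in `t̃`, and the two substitutions are inverse to each other. -/
structure TimeChange (A : Type*) [CommRing A] where
  new : ℕ+ → TimeSeries A
  old : ℕ+ → TimeSeries A
  new_triangular : IsTriangular new
  old_triangular : IsTriangular old
  new_old : ∀ n, MvPowerSeries.subst old (new n) = MvPowerSeries.X n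
  old_new : ∀ n, MvPowerSeries.subst new (old n) = MvPowerSeries.X n

namespace TimeChange

/-- Rewrite a function of `t` as a function of `t̃`. -/
noncomputable def toNew (c : TimeChange A) : TimeSeries A →+ TimeSeries A :=
  (MvPowerSeries.substAlgHom (R := A) c.old_triangular.hasSubst : _ →ₐ[A] _).toAddMonoidHom

/-- Rewrite a function of `t̃` as a function of `t`. -/
noncomputable def toOld (c : TimeChange A) : TimeSeries A →+ TimeSeries A :=
  (MvPowerSeries.substAlgHom (R := A) c.new_triangular.hasSubst : _ →ₐ[A] _).toAddMonoidHom

/-- `∂/∂t̃_n` acting on functions of `t`. -/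
noncomputable def dtNew (c : TimeChange A) (n : ℕ+) : TimeSeries A →+ TimeSeries A :=
  c.toOld.comp ((dt n).comp c.toNew)

end TimeChange

end Times

/-!
The Zakharov–Shabat equations say that the connection with covariant derivatives
`D_n X = ∂_n X - [B_n, X]` is flat, and a Lax operator is a horizontal `L = Λ + ⋯`. An `X` of
order `p` with `D_m X` of order less than `m + p` for all large `m` has a leading coefficient that
is `m`-periodic in `s` for all large `m`, hence constant in `s`; comparing with known almost
horizontal matrices and descending on the order gives the whole theorem.

Existence: `D_m B_n = ∂_n B_m` has order less than `m`, so `B_{n+1} B_n⁻¹` is horizontal up to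
order `m - n`. Correcting by combinations of powers of such quotients yields, in the limit,
a monic `P` with all `D_m P` of order at most `0`. The leading coefficients of the `D_m P` are then
constant in `s` and form a closed form by flatness; its primitive removes one more order, and so on.

Change of times: the same descent against the powers of `L` gives `B_n = ∑_j p_{n,j} L^j` modulo
negative order with scalar `p_{n,j}`. Flatness makes `(p_{n,j})_n` closed for every `j`, so
`p_{n,j} = ∂_n τ_j`, and one takes `t̃_j = τ_j` for `j ≥ 1` and `f₀ = τ_0`. If `t_j` has weight `j`,
then `τ_j` is `t_j` plus terms of higher weight, so the substitution is invertible.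
-/

namespace BandMat

section Order

variable {R S : Type*} [CommRing R] [CommRing S]

theorem ext_coeff {X Y : BandMat R} (h : ∀ j s, X.coeff j s = Y.coeff j s) : X = Y :=
  ext' fun i j => by simpa only [coeff, add_sub_cancel] using h (j - i) i

@[simp] theorem coeff_zero (j s : ℤ) : (0 : BandMat R).coeff j s = 0 := rfl

@[simp] theorem coeff_add (X Y : BandMat R) (j s : ℤ) :
    (X + Y).coeff j s = X.coeff j s + Y.coeff j s := rfl

@[simp] theorem coeff_sub (X Y : BandMat R) (j s : ℤ) :
    (X - Y).coeff j s = X.coeff j s - Y.coeff j s := rfl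

@[simp] theorem coeff_smul (c : R) (X : BandMat R) (j s : ℤ) :
    (c • X).coeff j s = c * X.coeff j s := rfl

theorem coeff_sum {ι : Type*} (t : Finset ι) (X : ι → BandMat R) (j s : ℤ) :
    (∑ i ∈ t, X i).coeff j s = ∑ i ∈ t, (X i).coeff j s :=
  map_sum (AddMonoidHom.mk' (fun Y : BandMat R => Y.coeff j s) fun _ _ => rfl) X t

theorem coeff_one (j s : ℤ) : (1 : BandMat R).coeff j s = if j = 0 then 1 else 0 := by
  rw [coeff, one_entry]
  exact if_congr (by omega) rfl rfl

@[simp] theorem coeff_plus (X : BandMat R) (j s : ℤ) :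
    X.plus.coeff j s = if 0 ≤ j then X.coeff j s else 0 :=
  if_congr (by omega) rfl rfl

@[simp] theorem coeff_mapEntries (φ : R →+ S) (X : BandMat R) (j s : ℤ) :
    (X.mapEntries φ).coeff j s = φ (X.coeff j s) := rfl

theorem mul_entry_support_finite (X Y : BandMat R) (i j : ℤ) :
    (Function.support fun k => X.1 i k * Y.1 k j).Finite := by
  obtain ⟨p, hp⟩ := X.2
  obtain ⟨q, hq⟩ := Y.2
  refine (Set.finite_Icc (j - q) (i + p)).subset fun k hk => ?_
  rw [Function.mem_support] at hk
  rw [Set.mem_Icc]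
  by_contra hcon
  apply hk
  by_cases h : i + p < k
  · rw [hp i k h, zero_mul]
  · rw [hq k j (by omega), mul_zero]

noncomputable instance : Algebra R (BandMat R) :=
  Algebra.ofModule
    (fun c X Y => ext' fun i j => by
      rw [smul_entry, mul_entry, mul_entry, mul_finsum' _ _ (mul_entry_support_finite X Y i j)]
      exact finsum_congr fun k => by rw [smul_entry, mul_assoc])
    (fun c X Y => ext' fun i j => by
      rw [smul_entry, mul_entry, mul_entry, mul_finsum' _ _ (mul_entry_support_finite X Y i j)]
      exact finsum_congr fun k => by rw [smul_entry, mul_left_comm])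

/-- The matrices `∑_{j ≤ p} x_j(s) Λ^j` of order at most `p`. -/
def ordLE (R : Type*) [CommRing R] (p : ℤ) : Submodule R (BandMat R) where
  carrier := {X | ∀ j s : ℤ, p < j → X.coeff j s = 0}
  zero_mem' _ _ _ := rfl
  add_mem' hX hY j s h := by rw [coeff_add, hX j s h, hY j s h, add_zero]
  smul_mem' c X hX j s h := by rw [coeff_smul, hX j s h, mul_zero]

theorem ordLE_mono {p q : ℤ} (hpq : p ≤ q) : ordLE R p ≤ ordLE R q :=
  fun _ hX j s hj => hX j s (hpq.trans_lt hj)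

theorem exists_mem_ordLE (X : BandMat R) : ∃ p, X ∈ ordLE R p := by
  obtain ⟨N, hN⟩ := X.2
  exact ⟨N, fun j s h => hN _ _ (by omega)⟩

theorem entry_eq_zero_of_mem_ordLE {X : BandMat R} {p : ℤ} (hX : X ∈ ordLE R p) (i j : ℤ)
    (hij : i + p < j) : X.1 i j = 0 := by
  simpa only [coeff, add_sub_cancel] using hX (j - i) i (by omega)

theorem mem_ordLE_sub_one {X : BandMat R} {p : ℤ} (hX : X ∈ ordLE R p)
    (h0 : ∀ s, X.coeff p s = 0) : X ∈ ordLE R (p - 1) := fun j s hj => by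
  rcases eq_or_lt_of_le (show p ≤ j by omega) with rfl | h
  · exact h0 s
  · exact hX j s h

theorem eq_zero_of_forall_mem_ordLE {X : BandMat R} (h : ∀ n : ℕ, X ∈ ordLE R (-n)) : X = 0 :=
  ext_coeff fun j s => h (1 - j).toNat j s (by omega)

theorem mul_mem_ordLE {X Y : BandMat R} {p q : ℤ} (hX : X ∈ ordLE R p) (hY : Y ∈ ordLE R q) :
    X * Y ∈ ordLE R (p + q) := fun j s h => by
  rw [coeff, mul_entry, mul_entry_eq_sum (entry_eq_zero_of_mem_ordLE hX)
    (entry_eq_zero_of_mem_ordLE hY) le_rfl le_rfl, Finset.Icc_eq_empty (by omega),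
    Finset.sum_empty]

theorem coeff_mul_top {X Y : BandMat R} {p q : ℤ} (hX : X ∈ ordLE R p) (hY : Y ∈ ordLE R q)
    (s : ℤ) : (X * Y).coeff (p + q) s = X.coeff p s * Y.coeff q (s + p) := by
  rw [coeff, mul_entry, mul_entry_eq_sum (entry_eq_zero_of_mem_ordLE hX)
    (entry_eq_zero_of_mem_ordLE hY) le_rfl le_rfl, show s + (p + q) - q = s + p by ring,
    Finset.Icc_self, Finset.sum_singleton, coeff, coeff, add_assoc]

theorem lie_mem_ordLE {X Y : BandMat R} {p q : ℤ} (hX : X ∈ ordLE R p) (hY : Y ∈ ordLE R q) :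
    ⁅X, Y⁆ ∈ ordLE R (p + q) := by
  rw [Ring.lie_def]
  exact sub_mem (mul_mem_ordLE hX hY) (add_comm q p ▸ mul_mem_ordLE hY hX)

theorem coeff_lie_top {X Y : BandMat R} {p q : ℤ} (hX : X ∈ ordLE R p) (hY : Y ∈ ordLE R q)
    (s : ℤ) : ⁅X, Y⁆.coeff (p + q) s =
      X.coeff p s * Y.coeff q (s + p) - Y.coeff q s * X.coeff p (s + q) := by
  rw [Ring.lie_def, coeff_sub, coeff_mul_top hX hY, add_comm p q, coeff_mul_top hY hX]

theorem mapEntries_mem_ordLE (φ : R →+ S) {X : BandMat R} {p : ℤ} (hX : X ∈ ordLE R p) :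
    X.mapEntries φ ∈ ordLE S p := fun j s h => by rw [coeff_mapEntries, hX j s h, map_zero]

theorem exists_limit (Z : ℕ → BandMat R) (hZ : ∀ n : ℕ, Z (n + 1) - Z n ∈ ordLE R (-n)) :
    ∃ W : BandMat R, ∀ n : ℕ, W - Z n ∈ ordLE R (-n) := by
  have hZadd (n k : ℕ) : Z (n + k) - Z n ∈ ordLE R (-n) := by
    induction k with
    | zero => rw [add_zero, sub_self]; exact zero_mem _
    | succ k ih =>
      have := add_mem (ordLE_mono (q := -n) (by push_cast; omega) (hZ (n + k))) ih
      rwa [sub_add_sub_cancel, add_assoc] at this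
  obtain ⟨p, hp⟩ := exists_mem_ordLE (Z 0)
  -- The entry `(i, j)` has stabilised as soon as `-n < j - i`.
  refine ⟨⟨Matrix.of fun i j => (Z (i - j + 1).toNat).1 i j, max p 0, fun i j h => ?_⟩,
    fun n j s hj => ?_⟩
  · rw [Matrix.of_apply, show (i - j + 1).toNat = 0 by omega]
    exact entry_eq_zero_of_mem_ordLE hp i j (by omega)
  · set m := (s - (s + j) + 1).toNat
    obtain ⟨k, rfl⟩ : ∃ k, n = m + k := Nat.exists_eq_add_of_le (by omega)
    have hk := hZadd m k j s (by omega)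
    rw [coeff_sub, sub_eq_zero] at hk ⊢
    exact hk.symm

theorem exists_limit_of_step {T : ℕ → BandMat R → Prop} {X₀ : BandMat R} (h₀ : T 0 X₀)
    (hstep : ∀ n X, T n X → ∃ X', T (n + 1) X' ∧ X' - X ∈ ordLE R (-n)) :
    ∃ W, ∀ n, ∃ X, T n X ∧ W - X ∈ ordLE R (-n) := by
  choose! next hT hsub using hstep
  let Z : ℕ → BandMat R := Nat.rec X₀ next
  have hZ (n : ℕ) : T n (Z n) := by
    induction n with
    | zero => exact h₀
    | succ n ih => exact hT n _ ih
  obtain ⟨W, hW⟩ := exists_limit Z fun n => hsub n _ (hZ n)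
  exact ⟨W, fun n => ⟨Z n, hZ n, hW n⟩⟩

end Order

section Monic

variable {R : Type*} [CommRing R]

/-- The matrix `x(s) Λ^j`. -/
def single (x : ℤ → R) (j : ℤ) : BandMat R :=
  ⟨Matrix.of fun i k => if k = i + j then x i else 0,
    j, fun i k h => by rw [Matrix.of_apply, if_neg (by omega)]⟩

theorem coeff_single (x : ℤ → R) (j k s : ℤ) :
    (single x j).coeff k s = if k = j then x s else 0 :=
  if_congr (by omega) rfl rfl

/-- `X = Λ^p + (terms of lower order)`. -/
def IsMonic (X : BandMat R) (p : ℤ) : Prop :=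
  X ∈ ordLE R p ∧ ∀ s, X.coeff p s = 1

theorem IsLaxForm.isMonic {L : BandMat R} (hL : L.IsLaxForm) : L.IsMonic 1 := hL

theorem IsMonicUpper.isMonic {X : BandMat R} {n : ℕ} (hX : X.IsMonicUpper n) : X.IsMonic n :=
  ⟨fun j s hj => hX.1 j s (Or.inr hj), hX.2⟩

theorem isMonic_single (p : ℤ) : (single (fun _ => (1 : R)) p).IsMonic p :=
  ⟨fun k s h => by rw [coeff_single, if_neg h.ne'], fun s => by rw [coeff_single, if_pos rfl]⟩

theorem isMonic_one : (1 : BandMat R).IsMonic 0 :=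
  ⟨fun j s hj => by rw [coeff_one, if_neg hj.ne'], fun s => by rw [coeff_one, if_pos rfl]⟩

namespace IsMonic

variable {X Y : BandMat R} {p q : ℤ}

theorem mul (hX : X.IsMonic p) (hY : Y.IsMonic q) : (X * Y).IsMonic (p + q) :=
  ⟨mul_mem_ordLE hX.1 hY.1, fun s => by rw [coeff_mul_top hX.1 hY.1, hX.2, hY.2, mul_one]⟩

theorem pow (hX : X.IsMonic p) (k : ℕ) : (X ^ k).IsMonic (k * p) := by
  induction k with
  | zero => simpa using isMonic_one
  | succ k ih => simpa [pow_succ, add_mul] using ih.mul hX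

theorem sub_mem (hX : X.IsMonic p) (hY : Y.IsMonic p) : X - Y ∈ ordLE R (p - 1) :=
  mem_ordLE_sub_one (_root_.sub_mem hX.1 hY.1) fun s => by
    rw [coeff_sub, hX.2, hY.2, sub_self]

theorem add (hX : X.IsMonic p) (hY : Y ∈ ordLE R q) (hq : q < p) : (X + Y).IsMonic p :=
  ⟨add_mem hX.1 (ordLE_mono hq.le hY), fun s => by rw [coeff_add, hX.2, hY p s hq, add_zero]⟩

theorem of_sub_mem (hX : X.IsMonic p) (hYX : Y - X ∈ ordLE R q) (hq : q < p) : Y.IsMonic p := by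
  simpa using hX.add hYX hq

theorem exists_left_inverse (hX : X.IsMonic p) : ∃ Y : BandMat R, Y.IsMonic (-p) ∧ Y * X = 1 := by
  -- `1 - Λ^{-p} X` has negative order, so `Λ^{-p} X` is inverted by a Neumann series.
  set E : BandMat R := single (fun _ => 1) (-p)
  set V : BandMat R := E * X
  have hE : E.IsMonic (-p) := isMonic_single _
  have hV : V.IsMonic 0 := by simpa using hE.mul hX
  let T (n : ℕ) (Y : BandMat R) : Prop := Y.IsMonic 0 ∧ 1 - Y * V ∈ ordLE R (-n - 1)
  have h₀ : T 0 1 := ⟨isMonic_one, by simpa using isMonic_one.sub_mem hV⟩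
  have hstep (n : ℕ) (Y : BandMat R) (hY : T n Y) :
      ∃ Y', T (n + 1) Y' ∧ Y' - Y ∈ ordLE R (-n) := by
    refine ⟨Y + (1 - Y * V), ⟨hY.1.add hY.2 (by omega), ?_⟩,
      by simpa using ordLE_mono (by omega) hY.2⟩
    have h : 1 - (Y + (1 - Y * V)) * V = (1 - Y * V) * (1 - V) := by noncomm_ring
    rw [h]
    exact ordLE_mono (by push_cast; omega) (mul_mem_ordLE hY.2 (isMonic_one.sub_mem hV))
  obtain ⟨W, hW⟩ := exists_limit_of_step h₀ hstep
  have hWV : 1 - W * V = 0 := eq_zero_of_forall_mem_ordLE fun n => by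
    obtain ⟨Y, hY, hWY⟩ := hW n
    have h : 1 - W * V = (1 - Y * V) - (W - Y) * V := by noncomm_ring
    rw [h]
    exact _root_.sub_mem (ordLE_mono (by omega) hY.2) (by simpa using mul_mem_ordLE hWY hV.1)
  have hW0 : W.IsMonic 0 := by
    obtain ⟨Y, hY, hWY⟩ := hW 1
    exact hY.1.of_sub_mem hWY (by norm_num)
  exact ⟨W * E, by simpa using hW0.mul hE, by rw [mul_assoc, ← sub_eq_zero.1 hWV]⟩

theorem exists_unit (hX : X.IsMonic p) :
    ∃ u : (BandMat R)ˣ, (u : BandMat R) = X ∧ (↑u⁻¹ : BandMat R).IsMonic (-p) := by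
  obtain ⟨Y, hY, hYX⟩ := hX.exists_left_inverse
  obtain ⟨Z, -, hZY⟩ := hY.exists_left_inverse
  have hZX : Z = X := left_inv_eq_right_inv hZY hYX
  exact ⟨⟨X, Y, hZX ▸ hZY, hYX⟩, rfl, hY⟩

theorem zpow {u : (BandMat R)ˣ} (hu : (u : BandMat R).IsMonic p)
    (hu' : (↑u⁻¹ : BandMat R).IsMonic (-p)) (k : ℤ) : (↑(u ^ k) : BandMat R).IsMonic (k * p) := by
  induction k using Int.induction_on with
  | zero => simpa using isMonic_one
  | succ k ih => simpa [zpow_add, add_mul] using ih.mul hu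
  | pred k ih => simpa [zpow_add, add_mul, sub_eq_add_neg] using ih.mul hu'

end IsMonic

end Monic

section CovariantDerivative

variable {k R : Type*} [CommRing k] [CommRing R] [Algebra k R]

/-- The entrywise action of a derivation of `R` on matrices. -/
def mapDeriv (δ : Derivation k R R) : BandMat R →+ BandMat R where
  toFun X := X.mapEntries (δ : R →ₗ[k] R).toAddMonoidHom
  map_zero' := ext' fun _ _ => map_zero δ
  map_add' _ _ := ext' fun _ _ => map_add δ _ _

/-- The covariant derivative `X ↦ δX - [b, X]` along the derivation `δ`. -/
noncomputable def covDeriv (δ : Derivation k R R) (b : BandMat R) : BandMat R →+ BandMat R where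
  toFun X := mapDeriv δ X - ⁅b, X⁆
  map_zero' := by rw [map_zero, Ring.lie_def, mul_zero, zero_mul, sub_self, sub_self]
  map_add' X Y := by rw [map_add]; simp only [Ring.lie_def]; noncomm_ring

variable (δ : Derivation k R R) (b : BandMat R)

theorem coeff_mapDeriv (X : BandMat R) (j s : ℤ) :
    (mapDeriv δ X).coeff j s = δ (X.coeff j s) := rfl

theorem covDeriv_apply (X : BandMat R) : covDeriv δ b X = mapDeriv δ X - ⁅b, X⁆ := rfl

theorem mapDeriv_smul (c : R) (X : BandMat R) :
    mapDeriv δ (c • X) = δ c • X + c • mapDeriv δ X := ext_coeff fun j s => by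
  simp only [coeff_mapDeriv, coeff_smul, coeff_add, δ.leibniz, smul_eq_mul]
  ring

theorem mapDeriv_one : mapDeriv δ (1 : BandMat R) = 0 := ext_coeff fun j s => by
  rw [coeff_mapDeriv, coeff_one, coeff_zero]
  split_ifs
  exacts [δ.map_one_eq_zero, map_zero δ]

theorem mapDeriv_mul (X Y : BandMat R) :
    mapDeriv δ (X * Y) = mapDeriv δ X * Y + X * mapDeriv δ Y := ext' fun i j => by
  have hfin (Z W : BandMat R) := mul_entry_support_finite Z W i j
  change δ ((X * Y).1 i j) = _
  rw [add_entry, mul_entry, mul_entry, mul_entry, ← finsum_add_distrib (hfin _ _) (hfin _ _),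
    map_finsum δ (hfin _ _)]
  refine finsum_congr fun l => ?_
  change δ (X.1 i l * Y.1 l j) = δ (X.1 i l) * Y.1 l j + X.1 i l * δ (Y.1 l j)
  rw [δ.leibniz, smul_eq_mul, smul_eq_mul]
  ring

theorem mapDeriv_mem_ordLE {X : BandMat R} {p : ℤ} (hX : X ∈ ordLE R p) :
    mapDeriv δ X ∈ ordLE R p := mapEntries_mem_ordLE _ hX

theorem IsMonic.mapDeriv_mem {X : BandMat R} {p : ℤ} (hX : X.IsMonic p) :
    mapDeriv δ X ∈ ordLE R (p - 1) :=
  mem_ordLE_sub_one (mapDeriv_mem_ordLE δ hX.1) fun s => by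
    rw [coeff_mapDeriv, hX.2, δ.map_one_eq_zero]

theorem covDeriv_smul (c : R) (X : BandMat R) :
    covDeriv δ b (c • X) = δ c • X + c • covDeriv δ b X := by
  rw [covDeriv_apply, covDeriv_apply, mapDeriv_smul, Ring.lie_def, Ring.lie_def, mul_smul_comm,
    smul_mul_assoc, ← smul_sub, smul_sub c (mapDeriv δ X), add_sub_assoc]

theorem covDeriv_one : covDeriv δ b 1 = 0 := by
  rw [covDeriv_apply, mapDeriv_one, Ring.lie_def, mul_one, one_mul, sub_self, sub_self]

theorem covDeriv_mul (X Y : BandMat R) :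
    covDeriv δ b (X * Y) = covDeriv δ b X * Y + X * covDeriv δ b Y := by
  simp only [covDeriv_apply, mapDeriv_mul, Ring.lie_def]
  noncomm_ring

variable {b} {X Y : BandMat R} {p q r d : ℤ}

theorem covDeriv_mem_ordLE (hb : b ∈ ordLE R q) (hq : 0 ≤ q) (hX : X ∈ ordLE R p) :
    covDeriv δ b X ∈ ordLE R (q + p) :=
  sub_mem (ordLE_mono (by omega) (mapDeriv_mem_ordLE δ hX)) (lie_mem_ordLE hb hX)

theorem coeff_covDeriv_top (hb : b.IsMonic q) (hq : 0 < q) (hX : X ∈ ordLE R p) (s : ℤ) :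
    (covDeriv δ b X).coeff (q + p) s = X.coeff p s - X.coeff p (s + q) := by
  rw [covDeriv_apply, coeff_sub, mapDeriv_mem_ordLE δ hX _ s (by omega),
    coeff_lie_top hb.1 hX, hb.2, hb.2]
  ring

theorem covDeriv_mul_mem_ordLE (hX : X ∈ ordLE R p) (hDX : covDeriv δ b X ∈ ordLE R (p + d))
    (hY : Y ∈ ordLE R q) (hDY : covDeriv δ b Y ∈ ordLE R (q + d)) :
    covDeriv δ b (X * Y) ∈ ordLE R (p + q + d) := by
  rw [covDeriv_mul]
  exact add_mem (ordLE_mono (by omega) (mul_mem_ordLE hDX hY))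
    (ordLE_mono (by omega) (mul_mem_ordLE hX hDY))

variable {u : (BandMat R)ˣ}

theorem covDeriv_inv_mem_ordLE (hu : (↑u⁻¹ : BandMat R) ∈ ordLE R (-p))
    (hDu : covDeriv δ b u ∈ ordLE R (p + d)) :
    covDeriv δ b ↑u⁻¹ ∈ ordLE R (-p + d) := by
  have hinv : covDeriv δ b ↑u⁻¹ = -(↑u⁻¹ * covDeriv δ b u * ↑u⁻¹) := by
    have h := covDeriv_mul δ b ↑u⁻¹ u
    rw [Units.inv_mul, covDeriv_one] at h
    rw [← neg_mul, ← eq_neg_of_add_eq_zero_left h.symm, Units.mul_inv_cancel_right]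
  rw [hinv]
  exact neg_mem (ordLE_mono (by omega) (mul_mem_ordLE (mul_mem_ordLE hu hDu) hu))

theorem covDeriv_zpow_mem_ordLE (hu : (u : BandMat R).IsMonic p)
    (hu' : (↑u⁻¹ : BandMat R).IsMonic (-p)) (hDu : covDeriv δ b u ∈ ordLE R (p + d)) (j : ℤ) :
    covDeriv δ b ↑(u ^ j) ∈ ordLE R (j * p + d) := by
  induction j using Int.induction_on with
  | zero => rw [zpow_zero, Units.val_one, covDeriv_one]; exact zero_mem _
  | succ j ih =>
    rw [zpow_add_one, Units.val_mul, add_mul, one_mul]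
    exact covDeriv_mul_mem_ordLE δ (hu.zpow hu' j).1 ih hu.1 hDu
  | pred j ih =>
    rw [zpow_sub_one, Units.val_mul, sub_mul, one_mul]
    exact covDeriv_mul_mem_ordLE δ (hu.zpow hu' _).1 ih hu'.1 (covDeriv_inv_mem_ordLE δ hu'.1 hDu)

end CovariantDerivative

section FlatConnection

open Filter

variable {k R : Type*} [CommRing k] [CommRing R] [Algebra k R]

/-- The Zakharov–Shabat equations `∂_n B_m - ∂_m B_n + [B_m, B_n] = 0` for derivations `δ n` in the
role of the `∂_n`: the connection with covariant derivatives `δ n - [B n, ·]` is flat. -/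
def ZakharovShabat (δ : ℕ+ → Derivation k R R) (B : ℕ+ → BandMat R) : Prop :=
  ∀ m n, mapDeriv (δ n) (B m) - mapDeriv (δ m) (B n) + ⁅B m, B n⁆ = 0

variable {δ : ℕ+ → Derivation k R R} {B : ℕ+ → BandMat R}

theorem ZakharovShabat.covDeriv_eq (hZS : ZakharovShabat δ B) (m n : ℕ+) :
    covDeriv (δ m) (B m) (B n) = mapDeriv (δ n) (B m) := by
  rw [covDeriv_apply, ← sub_eq_zero, ← neg_eq_zero, ← hZS m n]
  abel

theorem ZakharovShabat.covDeriv_mem_ordLE (hZS : ZakharovShabat δ B)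
    (hB : ∀ n : ℕ+, (B n).IsMonic n) (m n : ℕ+) :
    covDeriv (δ m) (B m) (B n) ∈ ordLE R (m - 1) := by
  rw [hZS.covDeriv_eq]
  exact (hB m).mapDeriv_mem _

theorem ZakharovShabat.covDeriv_comm (hZS : ZakharovShabat δ B)
    (hδ : ∀ m n f, δ m (δ n f) = δ n (δ m f)) (m n : ℕ+) (X : BandMat R) :
    covDeriv (δ m) (B m) (covDeriv (δ n) (B n) X) =
      covDeriv (δ n) (B n) (covDeriv (δ m) (B m) X) := by
  have hcomm : mapDeriv (δ m) (mapDeriv (δ n) X) = mapDeriv (δ n) (mapDeriv (δ m) X) :=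
    ext' fun _ _ => hδ m n _
  have hcurv : mapDeriv (δ n) (B m) = mapDeriv (δ m) (B n) - ⁅B m, B n⁆ := by
    rw [← sub_eq_zero, ← hZS m n]
    abel
  simp only [covDeriv_apply, map_sub, Ring.lie_def, mapDeriv_mul, hcomm, hcurv]
  noncomm_ring

theorem apply_eq_apply_zero_of_eventually_periodic {α : Type*} {x : ℤ → α}
    (hx : ∀ᶠ m : ℕ+ in atTop, Function.Periodic x m) (s : ℤ) : x s = x 0 := by
  obtain ⟨m, hm⟩ := eventually_atTop.1 hx
  have hper : Function.Periodic x 1 := by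
    simpa using (hm (m + 1) (PNat.lt_add_right m 1).le).sub_period (hm m le_rfl)
  simpa using hper.int_mul_eq s

theorem eventually_le_coe (c : ℤ) : ∀ᶠ m : ℕ+ in atTop, c ≤ m :=
  (tendsto_natCast_atTop_atTop.comp tendsto_PNat_val_atTop_atTop).eventually_ge_atTop c

variable (δ B) in
/-- The matrices `X` whose covariant derivatives `D_m X` have order at most `m + q` for all large
`m`; a generic matrix of order `p` only satisfies this for `q ≥ p`. -/
def almostHorizontal (q : ℤ) : Submodule R (BandMat R) where
  carrier := {X | ∀ᶠ m : ℕ+ in atTop, covDeriv (δ m) (B m) X ∈ ordLE R (m + q)}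
  zero_mem' := Eventually.of_forall fun m => by rw [map_zero]; exact zero_mem _
  add_mem' hX hY := by
    filter_upwards [hX, hY] with m hXm hYm
    rw [map_add]
    exact add_mem hXm hYm
  smul_mem' c X hX := by
    obtain ⟨p, hp⟩ := exists_mem_ordLE X
    filter_upwards [hX, eventually_le_coe (p - q)] with m hXm hm
    rw [covDeriv_smul]
    exact add_mem (Submodule.smul_mem _ _ (ordLE_mono (by omega) hp)) (Submodule.smul_mem _ _ hXm)

theorem coeff_eq_coeff_zero (hB : ∀ n : ℕ+, (B n).IsMonic n) {X : BandMat R} {p q : ℤ}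
    (hX : X ∈ ordLE R p) (hXq : X ∈ almostHorizontal δ B q) (hqp : q < p) (s : ℤ) :
    X.coeff p s = X.coeff p 0 := by
  refine apply_eq_apply_zero_of_eventually_periodic ?_ s
  filter_upwards [hXq] with m hm s
  have h := hm (m + p) s (by omega)
  rw [coeff_covDeriv_top _ (hB m) (by positivity) hX, sub_eq_zero] at h
  exact h.symm

theorem covDeriv_mem_almostHorizontal (hδ : ∀ m n f, δ m (δ n f) = δ n (δ m f))
    (hB : ∀ n : ℕ+, (B n).IsMonic n) (hZS : ZakharovShabat δ B) {X : BandMat R} {q : ℤ} (l : ℕ+)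
    (hX : X ∈ almostHorizontal δ B q) :
    covDeriv (δ l) (B l) X ∈ almostHorizontal δ B (l + q) := by
  filter_upwards [hX] with m hm
  rw [hZS.covDeriv_comm hδ]
  exact ordLE_mono (by omega) (covDeriv_mem_ordLE _ (hB l).1 (by positivity) hm)

theorem sub_smul_mem_ordLE {X E : BandMat R} {p : ℤ} {c : R} (hX : X ∈ ordLE R p)
    (hc : ∀ s, X.coeff p s = c) (hE : E.IsMonic p) : X - c • E ∈ ordLE R (p - 1) :=
  mem_ordLE_sub_one (sub_mem hX (Submodule.smul_mem _ c hE.1)) fun s => by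
    rw [coeff_sub, coeff_smul, hc, hE.2, mul_one, sub_self]

theorem exists_sub_mem_ordLE (hB : ∀ n : ℕ+, (B n).IsMonic n) {W : Submodule R (BandMat R)}
    {p q : ℤ} (hqp : q ≤ p) (hW : W ≤ almostHorizontal δ B q)
    (hmonic : ∀ j, q < j → j ≤ p → ∃ E ∈ W, E.IsMonic j) {X : BandMat R}
    (hX : X ∈ ordLE R p) (hXq : X ∈ almostHorizontal δ B q) :
    ∃ Y ∈ W, X - Y ∈ ordLE R q := by
  induction p, hqp using Int.leInduction generalizing X with
  | base => exact ⟨0, W.zero_mem, by rwa [sub_zero]⟩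
  | succ p hqp ih =>
    obtain ⟨E, hEW, hE⟩ := hmonic (p + 1) (by omega) le_rfl
    set c := X.coeff (p + 1) 0
    have hcE : c • E ∈ W := W.smul_mem c hEW
    have hsub : X - c • E ∈ ordLE R p := by
      simpa using sub_smul_mem_ordLE hX (coeff_eq_coeff_zero hB hX hXq (by omega)) hE
    obtain ⟨Y, hY, hXY⟩ := ih (fun j hqj hjp => hmonic j hqj (by omega)) hsub
      (sub_mem hXq (hW hcE))
    exact ⟨c • E + Y, W.add_mem hcE hY, by rwa [← sub_sub]⟩

variable (δ B) in
/-- The matrices `X` of order at most `p` such that `D_m X` has order at most `max p (r m)` for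
every `m`. The maximum is what makes this a submodule over the nonconstant scalars `R`. -/
def boundedCovDeriv (p : ℤ) (r : ℕ+ → ℤ) : Submodule R (BandMat R) where
  carrier := {X | X ∈ ordLE R p ∧ ∀ m, covDeriv (δ m) (B m) X ∈ ordLE R (max p (r m))}
  zero_mem' := ⟨zero_mem _, fun m => by rw [map_zero]; exact zero_mem _⟩
  add_mem' hX hY := ⟨add_mem hX.1 hY.1, fun m => by
    rw [map_add]
    exact add_mem (hX.2 m) (hY.2 m)⟩
  smul_mem' c X hX := ⟨Submodule.smul_mem _ c hX.1, fun m => by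
    rw [covDeriv_smul]
    exact add_mem (Submodule.smul_mem _ _ (ordLE_mono (le_max_left _ _) hX.1))
      (Submodule.smul_mem _ _ (hX.2 m))⟩

theorem boundedCovDeriv_le_almostHorizontal {p q : ℤ} {r : ℕ+ → ℤ}
    (hr : ∀ᶠ m in atTop, r m ≤ m + q) :
    boundedCovDeriv δ B p r ≤ almostHorizontal δ B q := fun X hX => by
  filter_upwards [eventually_le_coe (p - q), hr] with m hm hrm
  exact ordLE_mono (max_le (by omega) hrm) (hX.2 m)

end FlatConnection

section Existence

open Filter

variable {k R : Type*} [CommRing k] [CommRing R] [Algebra k R]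
  {δ : ℕ+ → Derivation k R R} {B : ℕ+ → BandMat R}

theorem exists_unit_covDeriv_mem_ordLE (hB : ∀ n : ℕ+, (B n).IsMonic n)
    (hZS : ZakharovShabat δ B) (n : ℕ+) :
    ∃ u : (BandMat R)ˣ, (u : BandMat R).IsMonic 1 ∧ (↑u⁻¹ : BandMat R).IsMonic (-1) ∧
      ∀ m : ℕ+, covDeriv (δ m) (B m) u ∈ ordLE R ((m : ℤ) - n) := by
  obtain ⟨v, hv, hv'⟩ := (hB n).exists_unit
  have hmonic : (B (n + 1) * ↑v⁻¹).IsMonic 1 := by simpa using (hB (n + 1)).mul hv'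
  obtain ⟨u, hu, hu'⟩ := hmonic.exists_unit
  refine ⟨u, hu ▸ hmonic, hu', fun m => ?_⟩
  have hDv : covDeriv (δ m) (B m) ↑v⁻¹ ∈ ordLE R (-n + (m - n - 1)) :=
    covDeriv_inv_mem_ordLE _ hv'.1 (ordLE_mono (by omega) (hv ▸ hZS.covDeriv_mem_ordLE hB m n))
  have hDB : covDeriv (δ m) (B m) (B (n + 1)) ∈ ordLE R (((n + 1 : ℕ+) : ℤ) + (m - n - 1)) :=
    ordLE_mono (by push_cast; omega) (hZS.covDeriv_mem_ordLE hB m (n + 1))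
  rw [hu]
  exact ordLE_mono (by push_cast; omega) (covDeriv_mul_mem_ordLE _ (hB (n + 1)).1 hDB hv'.1 hDv)

theorem exists_covDeriv_mem_ordLE_succ (hB : ∀ n : ℕ+, (B n).IsMonic n)
    (hZS : ZakharovShabat δ B) {n : ℕ} {X : BandMat R} (hX : X.IsMonic 1)
    (hDX : ∀ m : ℕ+, covDeriv (δ m) (B m) X ∈ ordLE R (max 0 ((m : ℤ) - n))) :
    ∃ X' : BandMat R, (X'.IsMonic 1 ∧
      ∀ m : ℕ+, covDeriv (δ m) (B m) X' ∈ ordLE R (max 0 ((m : ℤ) - (n + 1 : ℕ)))) ∧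
        X' - X ∈ ordLE R (-n) := by
  obtain ⟨u, hu, hu', hDu⟩ := exists_unit_covDeriv_mem_ordLE hB hZS n.succPNat
  simp only [Nat.succPNat_coe, Nat.succ_eq_add_one] at hDu
  let W := boundedCovDeriv δ B 0 fun m => (m : ℤ) - (n + 1 : ℕ)
  have hW : W ≤ almostHorizontal δ B (-n) :=
    boundedCovDeriv_le_almostHorizontal (.of_forall fun m => by omega)
  have hpow (j : ℤ) (_ : -n < j) (hj : j ≤ 0) : ∃ E ∈ W, E.IsMonic j := by
    refine ⟨↑(u ^ j), ⟨ordLE_mono (by omega) (hu.zpow hu' j).1, fun m => ?_⟩,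
      by simpa using hu.zpow hu' j⟩
    exact ordLE_mono (q := max 0 ((m : ℤ) - (n + 1 : ℕ))) (by omega) <|
      covDeriv_zpow_mem_ordLE (d := (m : ℤ) - (n + 1 : ℕ) - 1) _ hu hu'
        (ordLE_mono (by omega) (hDu m)) j
  have hdiff : X - u ∈ almostHorizontal δ B (-n) := by
    filter_upwards [eventually_le_coe (n : ℤ)] with m hm
    rw [map_sub]
    exact sub_mem (ordLE_mono (by omega) (hDX m)) (ordLE_mono (by omega) (hDu m))
  obtain ⟨Y, hY, hXY⟩ := exists_sub_mem_ordLE hB (by omega) hW hpow (hX.sub_mem hu) hdiff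
  refine ⟨u + Y, ⟨hu.add hY.1 one_pos, fun m => ?_⟩, ?_⟩
  · rw [map_add]
    exact add_mem (ordLE_mono (le_max_right _ _) (hDu m)) (hY.2 m)
  · rw [← neg_sub, sub_add_eq_sub_sub]
    exact neg_mem hXY

theorem exists_isMonic_covDeriv_mem_ordLE_zero (hB : ∀ n : ℕ+, (B n).IsMonic n)
    (hZS : ZakharovShabat δ B) :
    ∃ P : BandMat R, P.IsMonic 1 ∧ ∀ m : ℕ+, covDeriv (δ m) (B m) P ∈ ordLE R 0 := by
  let T (n : ℕ) (X : BandMat R) : Prop :=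
    X.IsMonic 1 ∧ ∀ m : ℕ+, covDeriv (δ m) (B m) X ∈ ordLE R (max 0 ((m : ℤ) - n))
  have h₀ : T 0 (B 1) :=
    ⟨hB 1, fun m => ordLE_mono (by push_cast; omega) (hZS.covDeriv_mem_ordLE hB m 1)⟩
  obtain ⟨P, hP⟩ := exists_limit_of_step h₀ fun n X hX =>
    exists_covDeriv_mem_ordLE_succ hB hZS hX.1 hX.2
  refine ⟨P, ?_, fun m => ?_⟩
  · obtain ⟨X, hX, hPX⟩ := hP 0
    exact hX.1.of_sub_mem hPX (by norm_num)
  · obtain ⟨X, hX, hPX⟩ := hP m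
    have hD := covDeriv_mem_ordLE (δ m) (hB m).1 (by positivity) hPX
    rw [map_sub] at hD
    simpa using add_mem (ordLE_mono (by omega) hD) (ordLE_mono (by simp) (hX.2 m))

theorem exists_isMonic_covDeriv_mem_ordLE_pred (hB : ∀ n : ℕ+, (B n).IsMonic n)
    (hZS : ZakharovShabat δ B) (j : ℤ) :
    ∃ E : BandMat R, E.IsMonic j ∧ ∀ m : ℕ+, covDeriv (δ m) (B m) E ∈ ordLE R (j - 1) := by
  obtain ⟨P, hP, hDP⟩ := exists_isMonic_covDeriv_mem_ordLE_zero hB hZS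
  obtain ⟨u, rfl, hu'⟩ := hP.exists_unit
  refine ⟨↑(u ^ j), by simpa using hP.zpow hu' j, fun m => ?_⟩
  simpa [sub_eq_add_neg] using covDeriv_zpow_mem_ordLE (d := -1) (δ m) hP hu'
    (by simpa using hDP m) j

theorem covDeriv_mem_ordLE_of_almostHorizontal (hB : ∀ n : ℕ+, (B n).IsMonic n)
    (hZS : ZakharovShabat δ B) {X : BandMat R} {p : ℤ} (hX : X ∈ ordLE R p)
    (hXq : ∀ q, X ∈ almostHorizontal δ B q) (l : ℕ+) : covDeriv (δ l) (B l) X ∈ ordLE R p := by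
  let W := boundedCovDeriv δ B p fun _ => p
  have hW (q : ℤ) : W ≤ almostHorizontal δ B q := boundedCovDeriv_le_almostHorizontal <| by
    filter_upwards [eventually_le_coe (p - q)] with m hm
    omega
  have hmonic (j : ℤ) (_ : p - l < j) (hj : j ≤ p) : ∃ E ∈ W, E.IsMonic j := by
    obtain ⟨E, hE, hDE⟩ := exists_isMonic_covDeriv_mem_ordLE_pred hB hZS j
    exact ⟨E, ⟨ordLE_mono hj hE.1, fun m => ordLE_mono (by omega) (hDE m)⟩, hE⟩
  obtain ⟨Y, hY, hXY⟩ := exists_sub_mem_ordLE hB (by omega) (hW _) hmonic hX (hXq _)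
  have hD := covDeriv_mem_ordLE (δ l) (hB l).1 (by positivity) hXY
  rw [map_sub] at hD
  simpa using add_mem (ordLE_mono (by omega) hD) (ordLE_mono (by simp) (hY.2 l))

theorem coeff_covDeriv_of_almostHorizontal (hB : ∀ n : ℕ+, (B n).IsMonic n)
    (hZS : ZakharovShabat δ B) {X : BandMat R} {p : ℤ} (hX : X ∈ ordLE R p)
    (hXq : ∀ q, X ∈ almostHorizontal δ B q) (l : ℕ+) (s : ℤ) :
    (covDeriv (δ l) (B l) X).coeff p s = δ l (X.coeff p 0) := by
  obtain ⟨E, hE, hDE⟩ := exists_isMonic_covDeriv_mem_ordLE_pred hB hZS p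
  set c := X.coeff p 0
  have hEq (q : ℤ) : E ∈ almostHorizontal δ B q := by
    filter_upwards [eventually_le_coe (p - q)] with m hm
    exact ordLE_mono (by omega) (hDE m)
  have hsub : X - c • E ∈ ordLE R (p - 1) :=
    sub_smul_mem_ordLE hX (coeff_eq_coeff_zero hB hX (hXq (p - 1)) (by omega)) hE
  have hD := covDeriv_mem_ordLE_of_almostHorizontal hB hZS hsub
    (fun q => sub_mem (hXq q) (Submodule.smul_mem _ c (hEq q))) l p s (by omega)
  rw [map_sub, covDeriv_smul, coeff_sub, coeff_add, coeff_smul, coeff_smul, hE.2, hDE l p s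
    (by omega), mul_one, mul_zero, add_zero, sub_eq_zero] at hD
  exact hD

theorem exists_covDeriv_mem_ordLE_of_exact (hB : ∀ n : ℕ+, (B n).IsMonic n)
    (hδ : ∀ m n f, δ m (δ n f) = δ n (δ m f)) (hZS : ZakharovShabat δ B)
    (hexact : ∀ a : ℕ+ → R, (∀ m n, δ m (a n) = δ n (a m)) → ∃ f, ∀ n, δ n f = a n)
    {p : ℤ} {L : BandMat R} (hL : ∀ m : ℕ+, covDeriv (δ m) (B m) L ∈ ordLE R p) :
    ∃ L' : BandMat R,
      (∀ m : ℕ+, covDeriv (δ m) (B m) L' ∈ ordLE R (p - 1)) ∧ L' - L ∈ ordLE R p := by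
  have hLq (q : ℤ) : L ∈ almostHorizontal δ B q := by
    filter_upwards [eventually_le_coe (p - q)] with m hm
    exact ordLE_mono (by omega) (hL m)
  have hDLq (m : ℕ+) (q : ℤ) : covDeriv (δ m) (B m) L ∈ almostHorizontal δ B q := by
    simpa using covDeriv_mem_almostHorizontal hδ hB hZS m (hLq (q - m))
  let a (m : ℕ+) : R := (covDeriv (δ m) (B m) L).coeff p 0
  have hclosed (m n : ℕ+) : δ m (a n) = δ n (a m) := by
    rw [← coeff_covDeriv_of_almostHorizontal hB hZS (hL n) (hDLq n) m 0, hZS.covDeriv_comm hδ,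
      coeff_covDeriv_of_almostHorizontal hB hZS (hL m) (hDLq m) n 0]
  obtain ⟨g, hg⟩ := hexact a hclosed
  obtain ⟨E, hE, hDE⟩ := exists_isMonic_covDeriv_mem_ordLE_pred hB hZS p
  refine ⟨L - g • E, fun m => ?_, ?_⟩
  · rw [map_sub, covDeriv_smul, hg, ← sub_sub]
    exact sub_mem
      (sub_smul_mem_ordLE (hL m) (coeff_eq_coeff_zero hB (hL m) (hDLq m (p - 1)) (by omega)) hE)
      (Submodule.smul_mem _ _ (hDE m))
  · rw [sub_sub_cancel_left]
    exact neg_mem (Submodule.smul_mem _ _ hE.1)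

theorem exists_isMonic_covDeriv_eq_zero (hB : ∀ n : ℕ+, (B n).IsMonic n)
    (hδ : ∀ m n f, δ m (δ n f) = δ n (δ m f)) (hZS : ZakharovShabat δ B)
    (hexact : ∀ a : ℕ+ → R, (∀ m n, δ m (a n) = δ n (a m)) → ∃ f, ∀ n, δ n f = a n) :
    ∃ L : BandMat R, L.IsMonic 1 ∧ ∀ m : ℕ+, covDeriv (δ m) (B m) L = 0 := by
  obtain ⟨P, hP, hDP⟩ := exists_isMonic_covDeriv_mem_ordLE_zero hB hZS
  let T (n : ℕ) (L : BandMat R) : Prop :=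
    L.IsMonic 1 ∧ ∀ m : ℕ+, covDeriv (δ m) (B m) L ∈ ordLE R (-n)
  have h₀ : T 0 P := ⟨hP, by simpa using hDP⟩
  have hstep (n : ℕ) (X : BandMat R) (hX : T n X) :
      ∃ X', T (n + 1) X' ∧ X' - X ∈ ordLE R (-n) := by
    obtain ⟨X', hX', hsub⟩ := exists_covDeriv_mem_ordLE_of_exact hB hδ hZS hexact hX.2
    exact ⟨X', ⟨hX.1.of_sub_mem hsub (by omega),
      fun m => ordLE_mono (by push_cast; omega) (hX' m)⟩, hsub⟩
  obtain ⟨L, hL⟩ := exists_limit_of_step h₀ hstep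
  refine ⟨L, ?_, fun m => eq_zero_of_forall_mem_ordLE fun n => ?_⟩
  · obtain ⟨X, hX, hLX⟩ := hL 0
    exact hX.1.of_sub_mem hLX (by norm_num)
  · obtain ⟨X, hX, hLX⟩ := hL (n + m)
    have hD := covDeriv_mem_ordLE (δ m) (hB m).1 (by positivity) hLX
    rw [map_sub] at hD
    simpa using add_mem (ordLE_mono (q := -n) (by push_cast; omega) hD)
      (ordLE_mono (by push_cast; omega) (hX.2 m))

end Existence

end BandMat

section PoincareLemma

open MvPowerSeries Finsupp

variable {σ A : Type*} [CommRing A]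

theorem pderiv_comm (m n : σ) (f : MvPowerSeries σ A) :
    pderiv A m (pderiv A n f) = pderiv A n (pderiv A m f) := by
  ext d
  rcases eq_or_ne m n with rfl | hmn
  · rfl
  · simp only [coeff_pderiv, Finsupp.add_apply, single_eq_of_ne hmn, single_eq_of_ne hmn.symm,
      add_zero, add_right_comm d (single m 1)]
    ring

theorem coeff_mul_eq_of_closed {a : σ → MvPowerSeries σ A}
    (ha : ∀ m n, pderiv A m (a n) = pderiv A n (a m)) {D : σ →₀ ℕ} {m n : σ} (hm : D m ≠ 0)
    (hn : D n ≠ 0) :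
    coeff (D - single m 1) (a m) * (D n : A) = coeff (D - single n 1) (a n) * (D m : A) := by
  rcases eq_or_ne m n with rfl | hmn
  · rfl
  obtain ⟨E, rfl⟩ : ∃ E, D = E + single m 1 + single n 1 :=
    ⟨D - single n 1 - single m 1, by
      rw [sub_add_single_one_cancel (by simpa [single_eq_of_ne hmn]), sub_add_single_one_cancel hn]⟩
  have h := congrArg (coeff E) (ha n m)
  rw [coeff_pderiv, coeff_pderiv] at h
  rw [add_tsub_cancel_right, add_right_comm, add_tsub_cancel_right]
  simpa [single_eq_of_ne hmn, single_eq_of_ne hmn.symm] using h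

theorem exists_pderiv_eq [Algebra ℚ A] (a : σ → MvPowerSeries σ A)
    (ha : ∀ m n, pderiv A m (a n) = pderiv A n (a m)) :
    ∃ f : MvPowerSeries σ A, coeff 0 f = 0 ∧ ∀ n, pderiv A n f = a n := by
  -- The radial integral `f(x) = ∫₀¹ ∑ₙ xₙ aₙ(sx) ds`.
  let f : MvPowerSeries σ A := fun D =>
    (D.degree : ℚ)⁻¹ • ∑ m ∈ D.support, coeff (D - single m 1) (a m)
  have hf (D : σ →₀ ℕ) : coeff D f =
    (D.degree : ℚ)⁻¹ • ∑ m ∈ D.support, coeff (D - single m 1) (a m) := rfl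
  refine ⟨f, by simp [hf], fun n => ?_⟩
  ext d
  set D := d + single n 1 with hD
  have hDn : D n ≠ 0 := by simp [hD]
  have hsum : (∑ m ∈ D.support, coeff (D - single m 1) (a m)) * (D n : A) =
      D.degree • coeff d (a n) := by
    rw [Finset.sum_mul, Finset.sum_congr rfl fun m hm =>
      coeff_mul_eq_of_closed ha (mem_support_iff.1 hm) hDn, ← Finset.mul_sum, ← Nat.cast_sum,
      ← degree_apply, hD, add_tsub_cancel_right, nsmul_eq_mul, mul_comm]
  have hdeg : (D.degree : ℚ) ≠ 0 := by
    rw [hD, map_add, degree_single]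
    positivity
  rw [coeff_pderiv, show (d n : A) + 1 = (D n : A) by simp [hD], ← hD, hf, smul_mul_assoc, hsum,
    ← Nat.cast_smul_eq_nsmul ℚ, inv_smul_smul₀ hdeg]

end PoincareLemma

section UnitriangularMaps

open MvPowerSeries

variable {σ A : Type*} [CommRing A] {w : σ → ℕ}

theorem injective_of_coeff_eq {T : MvPowerSeries σ A →+ MvPowerSeries σ A}
    (hT : ∀ f (d : σ →₀ ℕ), (∀ e, Finsupp.weight w e < Finsupp.weight w d → coeff e f = 0) →
      coeff d (T f) = coeff d f) :
    Function.Injective T := by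
  refine (injective_iff_map_eq_zero T).2 fun f hf => ?_
  ext d
  induction h : Finsupp.weight w d using Nat.strong_induction_on generalizing d with
  | _ n ih => rw [← hT f d fun e he => ih _ (h ▸ he) e rfl, hf]

theorem surjective_of_coeff_eq {T : MvPowerSeries σ A →+ MvPowerSeries σ A}
    (hT : ∀ f (d : σ →₀ ℕ), (∀ e, Finsupp.weight w e < Finsupp.weight w d → coeff e f = 0) →
      coeff d (T f) = coeff d f) :
    Function.Surjective T := fun g => by
  -- The Neumann series `f = ∑ₖ (1 - T)ᵏ g` is finite in every weight.
  let r (k : ℕ) : MvPowerSeries σ A := (fun x => x - T x)^[k] g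
  have hr (k : ℕ) : r (k + 1) = r k - T (r k) := Function.iterate_succ_apply' _ _ _
  have hrk (k : ℕ) : ∀ d : σ →₀ ℕ, Finsupp.weight w d < k → coeff d (r k) = 0 := by
    induction k with
    | zero => exact fun d hd => absurd hd (Nat.not_lt_zero _)
    | succ k ih =>
      intro d hd
      rw [hr, map_sub, hT _ d fun e he => ih e (by omega), sub_self]
  have hsum (n : ℕ) : T (∑ k ∈ Finset.range n, r k) = g - r n := by
    rw [map_sum, Finset.sum_congr rfl fun k _ => show T (r k) = r k - r (k + 1) by
      rw [hr, sub_sub_cancel], Finset.sum_range_sub']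
    rfl
  let f : MvPowerSeries σ A := fun d => coeff d (∑ k ∈ Finset.range (Finsupp.weight w d + 1), r k)
  have hf (n : ℕ) (e : σ →₀ ℕ) (he : Finsupp.weight w e < n) :
      coeff e (f - ∑ k ∈ Finset.range n, r k) = 0 := by
    rw [map_sub, sub_eq_zero]
    change coeff e (∑ k ∈ Finset.range (Finsupp.weight w e + 1), r k) = _
    rw [map_sum, map_sum]
    exact Finset.sum_subset (Finset.range_subset_range.2 he) fun k _ hk =>
      hrk k e (by simpa using hk)
  refine ⟨f, ?_⟩
  ext d
  set n := Finsupp.weight w d + 1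
  have h := hT _ d fun e he => hf n e (by omega)
  rw [hf n d (Nat.lt_succ_self _), map_sub, hsum, map_sub, map_sub, hrk n d (Nat.lt_succ_self _),
    sub_zero, sub_eq_zero] at h
  exact h

theorem le_weightedOrder_prod_sub_prod {ι : Type*} {v : ι → ℕ} {f g : ι → MvPowerSeries σ A}
    (hg : ∀ i, v i ≤ (g i).weightedOrder w) (hfg : ∀ i, v i + 1 ≤ (f i - g i).weightedOrder w)
    (s : Multiset ι) :
    (s.map v).sum ≤ (s.map g).prod.weightedOrder w ∧
      (s.map v).sum + 1 ≤ ((s.map f).prod - (s.map g).prod).weightedOrder w := by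
  induction s using Multiset.induction with
  | empty => simp
  | cons i s ih =>
    obtain ⟨hM, hPM⟩ := ih
    simp only [Multiset.map_cons, Multiset.prod_cons, Multiset.sum_cons, Nat.cast_add]
    set P := (s.map f).prod
    set M := (s.map g).prod
    have hP : ((s.map v).sum : ℕ∞) ≤ P.weightedOrder w := by
      rw [← sub_add_cancel P M]
      exact (le_min (le_self_add.trans hPM) hM).trans (min_weightedOrder_le_add w)
    refine ⟨(add_le_add (hg i) hM).trans (le_weightedOrder_mul w), ?_⟩
    have hsplit : f i * P - g i * M = (f i - g i) * P + g i * (P - M) := by ring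
    rw [hsplit]
    refine (le_min ?_ ?_).trans (min_weightedOrder_le_add w)
    · rw [add_right_comm]
      exact (add_le_add (hfg i) hP).trans (le_weightedOrder_mul w)
    · rw [add_assoc]
      exact (add_le_add (hg i) hPM).trans (le_weightedOrder_mul w)

variable {a : σ → MvPowerSeries σ A}

theorem coeff_prod_pow_eq (ha : ∀ i, (w i : ℕ∞) + 1 ≤ (a i - X i).weightedOrder w) {d e : σ →₀ ℕ}
    (hde : Finsupp.weight w d ≤ Finsupp.weight w e) :
    coeff d (e.prod fun i k => a i ^ k) = coeff d (monomial e (1 : A)) := by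
  classical
  have hX (i : σ) : (w i : ℕ∞) ≤ (X i : MvPowerSeries σ A).weightedOrder w :=
    le_weightedOrder w fun d hd => by
      rw [coeff_X, if_neg]
      rintro rfl
      simp [Finsupp.weight_single] at hd
  have hprod (b : σ → MvPowerSeries σ A) :
      ((Finsupp.toMultiset e).map b).prod = e.prod fun i k => b i ^ k := by
    simp [Finset.prod_multiset_map_count, Finsupp.prod]
  have hsum : ((Finsupp.toMultiset e).map w).sum = Finsupp.weight w e := by
    simp [Finset.sum_multiset_map_count, Finsupp.weight_apply, Finsupp.sum]
  have h := (le_weightedOrder_prod_sub_prod hX ha (Finsupp.toMultiset e)).2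
  rw [hprod, hprod, ← monomial_one_eq, hsum] at h
  rw [← sub_eq_zero, ← map_sub]
  refine coeff_eq_zero_of_lt_weightedOrder w (h.trans_lt' ?_)
  exact_mod_cast Nat.lt_succ_of_le hde

theorem coeff_subst_eq (hs : HasSubst a) (ha : ∀ i, (w i : ℕ∞) + 1 ≤ (a i - X i).weightedOrder w)
    {f : MvPowerSeries σ A} {d : σ →₀ ℕ}
    (hf : ∀ e, Finsupp.weight w e < Finsupp.weight w d → coeff e f = 0) :
    coeff d (subst a f) = coeff d f := by
  classical
  rw [coeff_subst hs, finsum_eq_single _ d]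
  · rw [coeff_prod_pow_eq ha le_rfl, coeff_monomial_same, smul_eq_mul, mul_one]
  · intro e he
    rcases lt_or_ge (Finsupp.weight w e) (Finsupp.weight w d) with hlt | hle
    · rw [hf e hlt, zero_smul]
    · rw [coeff_prod_pow_eq ha hle, coeff_monomial_ne he.symm, smul_zero]

theorem subst_bijective (hs : HasSubst a) (ha : ∀ i, (w i : ℕ∞) + 1 ≤ (a i - X i).weightedOrder w) :
    Function.Bijective (subst a : MvPowerSeries σ A → MvPowerSeries σ A) := by
  let T : MvPowerSeries σ A →+ MvPowerSeries σ A := (substAlgHom hs : _ →ₐ[A] _).toAddMonoidHom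
  have hT : ⇑T = subst a := coe_substAlgHom hs
  have hcoeff (f : MvPowerSeries σ A) (d : σ →₀ ℕ)
      (hf : ∀ e, Finsupp.weight w e < Finsupp.weight w d → coeff e f = 0) :
      coeff d (T f) = coeff d f := by
    rw [hT, coeff_subst_eq hs ha hf]
  exact hT ▸ ⟨injective_of_coeff_eq hcoeff, surjective_of_coeff_eq hcoeff⟩

end UnitriangularMaps

section ChainRule

open MvPowerSeries
open scoped MvPowerSeries.WithPiTopology

variable {σ τ A : Type*} [CommRing A]

theorem continuous_pderiv [TopologicalSpace A] [IsTopologicalRing A] (i : σ) :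
    Continuous (pderiv A i : MvPowerSeries σ A → MvPowerSeries σ A) :=
  continuous_pi fun d => by
    change Continuous fun f => coeff d (pderiv A i f)
    simp only [coeff_pderiv]
    exact (WithPiTopology.continuous_coeff A _).mul continuous_const

theorem derivation_aeval {R : Type*} [CommRing R] [Algebra A R] (D : Derivation A R R) {a : σ → R}
    {s : Finset σ} (hs : ∀ k ∉ s, D (a k) = 0) (p : MvPolynomial σ A) :
    D (MvPolynomial.aeval a p) =
      ∑ k ∈ s, D (a k) * MvPolynomial.aeval a (MvPolynomial.pderiv k p) := by
  classical
  induction p using MvPolynomial.induction_on with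
  | C r => simp
  | add p q hp hq => simp [hp, hq, mul_add, Finset.sum_add_distrib]
  | mul_X p n hp =>
    have hX : ∑ k ∈ s, D (a k) * MvPolynomial.aeval a (MvPolynomial.pderiv k
        (MvPolynomial.X n : MvPolynomial σ A)) = D (a n) := by
      simp only [MvPolynomial.pderiv_X, Pi.single_apply, apply_ite (MvPolynomial.aeval a), map_one,
        map_zero, mul_ite, mul_one, mul_zero, Finset.sum_ite_eq]
      exact ite_eq_left_iff.2 fun hn => (hs n hn).symm
    simp only [map_mul, Derivation.leibniz, smul_eq_mul, map_add, MvPolynomial.aeval_X, hp, mul_add,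
      mul_left_comm (D _), Finset.sum_add_distrib, ← Finset.mul_sum, hX]

theorem pderiv_subst {a : σ → MvPowerSeries τ A} (ha : HasSubst a) {i : τ} {s : Finset σ}
    (hs : ∀ k ∉ s, pderiv A i (a k) = 0) (f : MvPowerSeries σ A) :
    pderiv A i (subst a f) = ∑ k ∈ s, pderiv A i (a k) * subst a (pderiv A k f) := by
  -- Both sides are continuous in `f` over discrete `A`, and polynomials are dense.
  let _ : UniformSpace A := ⊥
  have hsubst := continuous_subst (R := A) ha
  have hsum : Continuous fun f => ∑ k ∈ s, pderiv A i (a k) * subst a (pderiv A k f) :=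
    continuous_finsetSum _ fun k _ => continuous_const.mul (hsubst.comp (continuous_pderiv k))
  refine congrFun (((continuous_pderiv i).comp hsubst).ext_on
    (WithPiTopology.denseRange_toMvPowerSeries (R := A) (σ := σ)) hsum ?_) f
  rintro _ ⟨p, rfl⟩
  simp only [Function.comp_apply, ← substAlgHom_apply ha, pderiv_coe, substAlgHom_coe]
  exact derivation_aeval _ hs p

end ChainRule

section TriangularChanges

open MvPowerSeries

variable {A : Type*} [CommRing A] {τ : ℕ+ → TimeSeries A}

theorem dt_apply (n : ℕ+) (f : TimeSeries A) : dt n f = pderiv A n f := rfl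

theorem dt_X_self (n : ℕ+) : dt n (X n : TimeSeries A) = 1 := pderiv_X_self

theorem dt_X_of_ne {i n : ℕ+} (h : n ≠ i) : dt i (X n : TimeSeries A) = 0 := pderiv_X_of_ne h

namespace IsTriangular

theorem coeff_zero (h : IsTriangular τ) (n : ℕ+) : coeff 0 (τ n) = 0 := by
  by_contra hne
  exact (h n 0 (by rwa [map_sub, coeff_zero_X, sub_zero])).1 rfl

theorem dt_eq_dt_X (h : IsTriangular τ) {i n : ℕ+} (hin : i ≤ n) :
    dt i (τ n) = dt i (X n) := by
  rw [← sub_eq_zero, ← map_sub, dt_apply]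
  ext d
  have hd : coeff (d + Finsupp.single i 1) (τ n - X n) = 0 := by
    by_contra hne
    exact ((h n _ hne).2 i (by simp)).not_ge hin
  rw [coeff_pderiv, hd, zero_mul, map_zero]

theorem le_weightedOrder (h : IsTriangular τ) (n : ℕ+) :
    ((n : ℕ) : ℕ∞) + 1 ≤ (τ n - X n).weightedOrder fun i : ℕ+ => (i : ℕ) := by
  refine MvPowerSeries.le_weightedOrder _ fun d hd => by_contra fun hne => ?_
  obtain ⟨hd0, hlt⟩ := h n d hne
  obtain ⟨i, hi⟩ := Finsupp.support_nonempty_iff.2 hd0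
  have hid := Finsupp.le_weight_of_ne_zero' (fun i : ℕ+ => (i : ℕ)) (Finsupp.mem_support_iff.1 hi)
  have hni : (n : ℕ) < i := hlt i hi
  have hdn : Finsupp.weight (fun i : ℕ+ => (i : ℕ)) d < n + 1 := by exact_mod_cast hd
  omega

theorem subst_bijective (h : IsTriangular τ) :
    Function.Bijective (subst τ : TimeSeries A → TimeSeries A) :=
  _root_.subst_bijective h.hasSubst h.le_weightedOrder

theorem coeff_zero_subst (h : IsTriangular τ) (f : TimeSeries A) :
    coeff 0 (subst τ f) = coeff 0 f :=
  coeff_subst_eq h.hasSubst h.le_weightedOrder fun e he => by simp at he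

theorem dt_subst (h : IsTriangular τ) (n : ℕ+) (f : TimeSeries A) :
    dt n (subst τ f) = ∑ k ∈ Finset.Icc 1 n, dt n (τ k) * subst τ (dt k f) := by
  refine pderiv_subst h.hasSubst (fun k hk => ?_) f
  have hnk : n < k := by simpa using hk
  exact (h.dt_eq_dt_X hnk.le).trans (dt_X_of_ne hnk.ne')

theorem dt_subst_eq_add (h : IsTriangular τ) (n : ℕ+) (f : TimeSeries A) :
    dt n (subst τ f) =
      subst τ (dt n f) + ∑ k ∈ Finset.Ico 1 n, dt n (τ k) * subst τ (dt k f) := by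
  rw [h.dt_subst, ← Finset.Ico_insert_right one_le, Finset.sum_insert (by simp),
    h.dt_eq_dt_X le_rfl, dt_X_self, one_mul]

end IsTriangular

theorem isTriangular_iff [IsAddTorsionFree A] :
    IsTriangular τ ↔
      ∀ n, coeff 0 (τ n) = 0 ∧ ∀ i ≤ n, dt i (τ n) = dt i (X n) := by
  refine ⟨fun h n => ⟨h.coeff_zero n, fun i => h.dt_eq_dt_X⟩, fun h n d hd => ⟨?_, ?_⟩⟩
  · rintro rfl
    exact hd (by rw [map_sub, (h n).1, coeff_zero_X, sub_zero])
  · intro i hi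
    by_contra! hin
    have hdt : pderiv A i (τ n - X n) = 0 := by
      rw [← dt_apply, map_sub, (h n).2 i hin, sub_self]
    have hdi := Finsupp.mem_support_iff.1 hi
    have hcoeff := congrArg (coeff (d - Finsupp.single i 1)) hdt
    rw [coeff_pderiv, Finsupp.sub_add_single_one_cancel hdi, map_zero, ← Nat.cast_add_one,
      mul_comm, ← nsmul_eq_mul, nsmul_eq_zero_iff_right (Nat.succ_ne_zero _)] at hcoeff
    exact hd hcoeff

namespace IsTriangular

theorem of_subst_eq_X [IsAddTorsionFree A] (h : IsTriangular τ) {υ : ℕ+ → TimeSeries A}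
    (hυ : ∀ n, subst τ (υ n) = X n) : IsTriangular υ := by
  refine isTriangular_iff.2 fun n => ⟨?_, fun i => ?_⟩
  · rw [← h.coeff_zero_subst, hυ, coeff_zero_X]
  induction i using PNat.strongInductionOn with
  | _ i ih =>
    intro hin
    apply h.subst_bijective.injective
    have hlow : ∀ k ∈ Finset.Ico 1 i, dt i (τ k) * subst τ (dt k (υ n)) = 0 := fun k hk => by
      have hki := (Finset.mem_Ico.1 hk).2
      rw [ih k hki (hki.le.trans hin), dt_X_of_ne (hki.trans_le hin).ne',
        ← substAlgHom_apply h.hasSubst, map_zero, mul_zero]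
    rw [← add_zero (subst τ (dt i (υ n))), ← Finset.sum_eq_zero hlow, ← h.dt_subst_eq_add, hυ]
    rcases eq_or_ne n i with rfl | hne
    · rw [dt_X_self, ← substAlgHom_apply h.hasSubst, map_one]
    · rw [dt_X_of_ne hne, ← substAlgHom_apply h.hasSubst, map_zero]

theorem exists_timeChange [IsAddTorsionFree A] (h : IsTriangular τ) :
    ∃ c : TimeChange A, c.new = τ := by
  choose υ hυ using fun n => h.subst_bijective.surjective (X n)
  have hυt := h.of_subst_eq_X hυ
  refine ⟨⟨τ, υ, h, hυt, fun n => h.subst_bijective.injective ?_, hυ⟩, rfl⟩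
  rw [subst_comp_subst_apply hυt.hasSubst h.hasSubst, funext hυ, subst_X h.hasSubst, subst_self]
  rfl

end IsTriangular

end TriangularChanges

namespace BandMat

variable {R S : Type*} [CommRing R] [CommRing S] (φ : R →+* S)

theorem mapEntries_mul (X Y : BandMat R) :
    (X * Y).mapEntries (φ : R →+ S) = X.mapEntries (φ : R →+ S) * Y.mapEntries (φ : R →+ S) :=
  ext' fun i j => by
    rw [mul_entry]
    change φ ((X * Y).1 i j) = _
    rw [mul_entry]
    exact (AddMonoidHom.map_finsum (φ : R →+ S) (mul_entry_support_finite X Y i j)).trans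
      (finsum_congr fun k => map_mul φ _ _)

theorem mapEntries_one : (1 : BandMat R).mapEntries (φ : R →+ S) = 1 :=
  ext_coeff fun j s => by
    simp only [coeff_mapEntries, coeff_one, apply_ite (φ : R →+ S), map_zero]
    simp

theorem mapEntries_pow (X : BandMat R) (k : ℕ) :
    (X ^ k).mapEntries (φ : R →+ S) = X.mapEntries (φ : R →+ S) ^ k := by
  induction k with
  | zero => rw [pow_zero, pow_zero, mapEntries_one]
  | succ k ih => rw [pow_succ, pow_succ, mapEntries_mul, ih]

theorem mapEntries_lie (X Y : BandMat R) :
    ⁅X, Y⁆.mapEntries (φ : R →+ S) = ⁅X.mapEntries (φ : R →+ S), Y.mapEntries (φ : R →+ S)⁆ := by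
  rw [Ring.lie_def, Ring.lie_def, ← mapEntries_mul, ← mapEntries_mul]
  exact ext_coeff fun j s => by simp only [coeff_mapEntries, coeff_sub, map_sub]

theorem mapEntries_plus (φ : R →+ S) (X : BandMat R) :
    X.plus.mapEntries φ = (X.mapEntries φ).plus :=
  ext_coeff fun j s => by
    rw [coeff_mapEntries, coeff_plus, coeff_plus, coeff_mapEntries, apply_ite φ, map_zero]

theorem IsLaxForm.mapEntries {X : BandMat R} (hX : X.IsLaxForm) :
    (X.mapEntries (φ : R →+ S)).IsLaxForm := by
  refine ⟨fun j s hj => ?_, fun s => ?_⟩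
  · rw [coeff_mapEntries, hX.1 j s hj, map_zero]
  · rw [coeff_mapEntries, hX.2]
    exact map_one φ

end BandMat

namespace TimeChange

open MvPowerSeries

variable {A : Type*} [CommRing A] (c : TimeChange A)

theorem toNew_apply (f : TimeSeries A) : c.toNew f = subst c.old f :=
  substAlgHom_apply c.old_triangular.hasSubst f

theorem toOld_apply (f : TimeSeries A) : c.toOld f = subst c.new f :=
  substAlgHom_apply c.new_triangular.hasSubst f

theorem toNew_toOld (f : TimeSeries A) : c.toNew (c.toOld f) = f := by
  rw [toNew_apply, toOld_apply, subst_comp_subst_apply c.new_triangular.hasSubst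
    c.old_triangular.hasSubst, funext c.new_old, subst_self]
  rfl

theorem toOld_toNew (f : TimeSeries A) : c.toOld (c.toNew f) = f := by
  rw [toNew_apply, toOld_apply, subst_comp_subst_apply c.old_triangular.hasSubst
    c.new_triangular.hasSubst, funext c.old_new, subst_self]
  rfl

theorem dt_eq_sum (n : ℕ+) (f : TimeSeries A) :
    dt n f = ∑ k ∈ Finset.Icc 1 n, dt n (c.new k) * c.dtNew k f := by
  rw [← congrArg (dt n) (c.toOld_toNew f), toOld_apply, c.new_triangular.dt_subst]
  exact Finset.sum_congr rfl fun k _ => by rw [← toOld_apply]; rfl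

theorem matDt_eq_sum (n : ℕ+) (X : BandMat (TimeSeries A)) :
    matDt n X = ∑ k ∈ Finset.Icc 1 n, dt n (c.new k) • X.mapEntries (c.dtNew k) := by
  refine BandMat.ext_coeff fun j s => (c.dt_eq_sum n (X.coeff j s)).trans ?_
  rw [BandMat.coeff_sum]
  rfl

theorem mapEntries_dtNew {X : BandMat (TimeSeries A)} {Y : ℕ+ → BandMat (TimeSeries A)}
    (h : ∀ n, matDt n X = ∑ k ∈ Finset.Icc 1 n, dt n (c.new k) • Y k) (n : ℕ+) :
    X.mapEntries (c.dtNew n) = Y n := by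
  induction n using PNat.strongInductionOn with
  | _ n ih =>
    have hn := (c.matDt_eq_sum n X).symm.trans (h n)
    rw [← Finset.Ico_insert_right one_le, Finset.sum_insert (by simp),
      Finset.sum_insert (by simp), c.new_triangular.dt_eq_dt_X le_rfl, dt_X_self, one_smul,
      one_smul, Finset.sum_congr rfl fun k hk => by rw [ih k (Finset.mem_Ico.1 hk).2]] at hn
    exact add_right_cancel hn

theorem isMKPLax {L : BandMat (TimeSeries A)} (hL : L.IsLaxForm)
    (h : ∀ n : ℕ+, L.mapEntries (c.dtNew n) = ⁅(L ^ (n : ℕ)).plus, L⁆) :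
    IsMKPLax (L.mapEntries c.toNew) := by
  let φ : TimeSeries A →+* TimeSeries A := (substAlgHom c.old_triangular.hasSubst : _ →ₐ[A] _)
  change IsMKPLax (L.mapEntries (φ : TimeSeries A →+ TimeSeries A))
  refine ⟨hL.mapEntries φ, fun n => ?_⟩
  rw [← BandMat.mapEntries_pow, ← BandMat.mapEntries_plus, ← BandMat.mapEntries_lie, ← h n]
  exact BandMat.ext' fun i j => (c.toNew_toOld (dt n (c.toNew (L.1 i j)))).symm

end TimeChange

namespace BandMat

section Recovery

open Filter Polynomial

variable {k R : Type*} [CommRing k] [CommRing R] [Algebra k R] {L : BandMat R}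

theorem aeval_mem_ordLE (hL : L.IsMonic 1) {p : R[X]} {N : ℕ} (hp : p.natDegree ≤ N) :
    aeval L p ∈ ordLE R N := by
  rw [aeval_eq_sum_range]
  refine sum_mem fun j hj => Submodule.smul_mem _ _ (ordLE_mono ?_ (hL.pow j).1)
  have := Finset.mem_range_succ_iff.1 hj
  omega

theorem coeff_aeval (hL : L.IsMonic 1) {p : R[X]} {N : ℕ} (hp : p.natDegree ≤ N) (s : ℤ) :
    (aeval L p).coeff N s = p.coeff N := by
  have hpow (j : ℕ) : (L ^ j).IsMonic j := by simpa using hL.pow j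
  rw [aeval_eq_sum_range' (Nat.lt_succ_of_le hp), Finset.sum_range_succ, coeff_add, coeff_sum,
    Finset.sum_eq_zero fun j hj => by
      rw [coeff_smul, (hpow j).1 N s (by simpa using hj), mul_zero],
    zero_add, coeff_smul, (hpow N).2, mul_one]

theorem coeff_eq_zero_of_aeval_mem_ordLE (hL : L.IsMonic 1) {p : R[X]} {q : ℤ}
    (hp : aeval L p ∈ ordLE R q) {j : ℕ} (hj : q < j) : p.coeff j = 0 := by
  by_contra hne
  have hlt : q < p.natDegree := hj.trans_le (by exact_mod_cast le_natDegree_of_ne_zero hne)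
  have hlead : p.leadingCoeff = 0 := by
    rw [leadingCoeff, ← coeff_aeval hL le_rfl 0]
    exact hp _ _ hlt
  exact hne (by rw [leadingCoeff_eq_zero.1 hlead, Polynomial.coeff_zero])

/-- A derivation `δ` of `R` extended to polynomials over `R` by acting on the coefficients. -/
noncomputable def coeffDeriv (δ : Derivation k R R) (p : R[X]) : R[X] :=
  PolynomialModule.equivPolynomial (δ.mapCoeffs p)

theorem coeff_coeffDeriv (δ : Derivation k R R) (p : R[X]) (j : ℕ) :
    (coeffDeriv δ p).coeff j = δ (p.coeff j) := rfl

theorem natDegree_coeffDeriv_le (δ : Derivation k R R) (p : R[X]) :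
    (coeffDeriv δ p).natDegree ≤ p.natDegree :=
  natDegree_le_iff_coeff_eq_zero.2 fun j hj => by
    rw [coeff_coeffDeriv, coeff_eq_zero_of_natDegree_lt hj, map_zero]

theorem covDeriv_pow {δ : Derivation k R R} {b : BandMat R} (hL : covDeriv δ b L = 0) (j : ℕ) :
    covDeriv δ b (L ^ j) = 0 := by
  induction j with
  | zero => rw [pow_zero, covDeriv_one]
  | succ j ih => rw [pow_succ, covDeriv_mul, ih, hL, zero_mul, mul_zero, add_zero]

theorem covDeriv_aeval {δ : Derivation k R R} {b : BandMat R} (hL : covDeriv δ b L = 0)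
    (p : R[X]) : covDeriv δ b (aeval L p) = aeval L (coeffDeriv δ p) := by
  induction p using Polynomial.induction_on' with
  | add p q hp hq => simp only [coeffDeriv, map_add] at hp hq ⊢; rw [hp, hq]
  | monomial j c =>
    rw [coeffDeriv, δ.mapCoeffs_monomial, PolynomialModule.equivPolynomial_single, aeval_monomial,
      aeval_monomial, ← Algebra.smul_def, ← Algebra.smul_def, covDeriv_smul, covDeriv_pow hL,
      smul_zero, add_zero]

variable {δ : ℕ+ → Derivation k R R} {B : ℕ+ → BandMat R}

theorem exists_sub_aeval_mem_ordLE (hB : ∀ n : ℕ+, (B n).IsMonic n) (hZS : ZakharovShabat δ B)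
    (hL : L.IsMonic 1) (hDL : ∀ m, covDeriv (δ m) (B m) L = 0) (n : ℕ+) :
    ∃ p : R[X], B n - aeval L p ∈ ordLE R (-1) := by
  have hW : LinearMap.range (aeval L).toLinearMap ≤ almostHorizontal δ B (-1) := by
    rintro _ ⟨p, rfl⟩
    filter_upwards [eventually_le_coe (p.natDegree + 1)] with m hm
    rw [AlgHom.toLinearMap_apply, covDeriv_aeval (hDL m)]
    exact ordLE_mono (by omega) (aeval_mem_ordLE hL (natDegree_coeffDeriv_le (δ m) p))
  have hBn : B n ∈ almostHorizontal δ B (-1) :=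
    Eventually.of_forall fun m => hZS.covDeriv_mem_ordLE hB m n
  obtain ⟨_, ⟨p, rfl⟩, hp⟩ := exists_sub_mem_ordLE (q := -1) hB (by omega) hW
    (fun j hj _ => ⟨L ^ j.toNat, ⟨X ^ j.toNat, by simp⟩, by
      simpa [Int.toNat_of_nonneg (show 0 ≤ j by omega)] using hL.pow j.toNat⟩) (hB n).1 hBn
  exact ⟨p, hp⟩

theorem coeff_eq_one_and_natDegree_le (hL : L.IsMonic 1) {b : BandMat R} {n : ℕ}
    (hb : b.IsMonic n) {p : R[X]} (hp : b - aeval L p ∈ ordLE R (-1)) :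
    p.coeff n = 1 ∧ p.natDegree ≤ n := by
  have hpn : (aeval L p).IsMonic n := hb.of_sub_mem (by rwa [← neg_mem_iff, neg_sub]) (by omega)
  have hdeg : p.natDegree ≤ n := natDegree_le_iff_coeff_eq_zero.2 fun j hj =>
    coeff_eq_zero_of_aeval_mem_ordLE hL hpn.1 (by exact_mod_cast hj)
  exact ⟨by rw [← coeff_aeval hL hdeg 0, hpn.2], hdeg⟩

theorem deriv_coeff_comm (hZS : ZakharovShabat δ B)
    (hL : L.IsMonic 1) (hDL : ∀ m, covDeriv (δ m) (B m) L = 0) {p : ℕ+ → R[X]}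
    (hp : ∀ n, B n - aeval L (p n) ∈ ordLE R (-1)) (m n : ℕ+) (j : ℕ) :
    δ m ((p n).coeff j) = δ n ((p m).coeff j) := by
  set P : ℕ+ → BandMat R := fun n => aeval L (p n)
  have hPP : P n * P m = P m * P n := by rw [← map_mul, mul_comm, map_mul]
  -- As the `P n` commute, only the differences `B n - P n` contribute to the commutator.
  have hflat : covDeriv (δ m) (B m) (P n) - covDeriv (δ n) (B n) (P m) =
      mapDeriv (δ n) (B m - P m) - mapDeriv (δ m) (B n - P n) + ⁅B m - P m, B n - P n⁆ := by
    have hcurv : mapDeriv (δ m) (B n) = mapDeriv (δ n) (B m) + ⁅B m, B n⁆ := by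
      rw [← hZS.covDeriv_eq m n, covDeriv_apply, sub_add_cancel]
    simp only [covDeriv_apply, map_sub, hcurv, Ring.lie_def, sub_mul, mul_sub, hPP]
    abel
  have hmem : aeval L (coeffDeriv (δ m) (p n) - coeffDeriv (δ n) (p m)) ∈ ordLE R (-1) := by
    rw [map_sub, ← covDeriv_aeval (hDL m), ← covDeriv_aeval (hDL n), hflat]
    exact add_mem (sub_mem (mapDeriv_mem_ordLE _ (hp m)) (mapDeriv_mem_ordLE _ (hp n)))
      (ordLE_mono (by omega) (lie_mem_ordLE (hp m) (hp n)))
  have hzero := coeff_eq_zero_of_aeval_mem_ordLE hL hmem (j := j) (by omega)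
  rwa [Polynomial.coeff_sub, sub_eq_zero] at hzero

end Recovery

section UpperPart

open Polynomial

variable {R : Type*} [CommRing R] {L X Y : BandMat R}

theorem IsMonicUpper.plus_eq {n : ℕ} (hX : X.IsMonicUpper n) : X.plus = X :=
  ext_coeff fun j s => by
    rw [coeff_plus, ite_eq_left_iff, not_le]
    exact fun hj => (hX.1 j s (Or.inl hj)).symm

theorem plus_eq_plus_of_sub_mem (hXY : X - Y ∈ ordLE R (-1)) : X.plus = Y.plus :=
  ext_coeff fun j s => by
    rw [coeff_plus, coeff_plus]
    exact if_ctx_congr Iff.rfl (fun hj => sub_eq_zero.1 (hXY j s (by omega))) fun _ => rfl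

theorem plus_one : (1 : BandMat R).plus = 1 :=
  ext_coeff fun j s => by
    rw [coeff_plus, coeff_one]
    split_ifs <;> first | rfl | omega

theorem plus_aeval {p : R[X]} {n : ℕ} (hp : p.natDegree ≤ n) :
    (aeval L p).plus = ∑ j ∈ Finset.range (n + 1), p.coeff j • (L ^ j).plus := by
  rw [aeval_eq_sum_range' (Nat.lt_succ_of_le hp)]
  refine ext_coeff fun j s => ?_
  simp only [coeff_plus, coeff_sum, coeff_smul]
  split_ifs with hj
  · rfl
  · simp only [mul_zero, Finset.sum_const_zero]

theorem lie_sum_smul_add_smul_one {ι : Type*} (t : Finset ι) (c : ι → R) (X : ι → BandMat R)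
    (c₀ : R) (Y : BandMat R) :
    ⁅∑ i ∈ t, c i • X i + c₀ • 1, Y⁆ = ∑ i ∈ t, c i • ⁅X i, Y⁆ := by
  simp only [Ring.lie_def, add_mul, mul_add, Finset.sum_mul, Finset.mul_sum, smul_mul_assoc,
    mul_smul_comm, one_mul, mul_one, add_sub_add_right_eq_sub, smul_sub, Finset.sum_sub_distrib]

end UpperPart

end BandMat

theorem sum_range_succ_eq_sum_Icc_one_add {M : Type*} [AddCommMonoid M] (F : ℕ → M) (n : ℕ+) :
    ∑ j ∈ Finset.range (n + 1), F j = ∑ k ∈ Finset.Icc 1 n, F k + F 0 := by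
  have h : ∑ j ∈ Finset.Icc 1 (n : ℕ), F j = ∑ k ∈ Finset.Icc 1 n, F k :=
    (congrArg (Finset.sum · F) (PNat.map_subtype_embedding_Icc 1 n)).symm.trans (Finset.sum_map ..)
  rw [← h, Finset.range_eq_Ico, Finset.sum_eq_sum_Ico_succ_bot n.val.succ_pos, add_comm]
  rfl

section LaxOperators

open BandMat Polynomial

variable {A : Type*} [CommRing A] {B : ℕ+ → BandMat (TimeSeries A)} {L : BandMat (TimeSeries A)}

theorem TimeChange.mapEntries_dtNew_eq_lie (c : TimeChange A) {f₀ : TimeSeries A}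
    (hLax : ∀ n : ℕ+, matDt n L = ⁅B n, L⁆)
    (hBsum : ∀ n : ℕ+, B n = ∑ k ∈ Finset.Icc 1 n, dt n (c.new k) • (L ^ (k : ℕ)).plus +
      dt n f₀ • (1 : BandMat (TimeSeries A))) (n : ℕ+) :
    L.mapEntries (c.dtNew n) = ⁅(L ^ (n : ℕ)).plus, L⁆ :=
  c.mapEntries_dtNew (Y := fun k => ⁅(L ^ (k : ℕ)).plus, L⁆)
    (fun n => by rw [hLax, hBsum, lie_sum_smul_add_smul_one]) n

variable [Algebra ℚ A]

theorem exists_isLaxForm_of_zakharovShabat (hB : ∀ n : ℕ+, (B n).IsMonic n)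
    (hZS : ZakharovShabat (MvPowerSeries.pderiv A) B) :
    ∃ L : BandMat (TimeSeries A), L.IsLaxForm ∧ ∀ n : ℕ+, matDt n L = ⁅B n, L⁆ := by
  obtain ⟨L, hL, hDL⟩ := exists_isMonic_covDeriv_eq_zero hB pderiv_comm hZS fun a ha =>
    (exists_pderiv_eq a ha).imp fun _ h => h.2
  exact ⟨L, hL, fun n => sub_eq_zero.1 (hDL n)⟩

theorem exists_timeChange_eq_sum_plus (hB : ∀ n : ℕ+, (B n).IsMonicUpper n)
    (hZS : ZakharovShabat (MvPowerSeries.pderiv A) B) (hL : L.IsLaxForm)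
    (hLax : ∀ n : ℕ+, matDt n L = ⁅B n, L⁆) :
    ∃ (c : TimeChange A) (f₀ : TimeSeries A), ∀ n : ℕ+, B n =
      ∑ k ∈ Finset.Icc 1 n, dt n (c.new k) • (L ^ (k : ℕ)).plus +
        dt n f₀ • (1 : BandMat (TimeSeries A)) := by
  have hDL (n : ℕ+) : covDeriv (MvPowerSeries.pderiv A n) (B n) L = 0 := sub_eq_zero.2 (hLax n)
  choose p hp using exists_sub_aeval_mem_ordLE (fun n => (hB n).isMonic) hZS hL.isMonic hDL
  have hlead (n : ℕ+) := coeff_eq_one_and_natDegree_le hL.isMonic (hB n).isMonic (hp n)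
  choose τ hτ₀ hτ using fun j : ℕ => exists_pderiv_eq (fun n => (p n).coeff j) fun m n =>
    deriv_coeff_comm hZS hL.isMonic hDL hp m n j
  have : IsAddTorsionFree A := .of_module_rat A
  have hτtri : IsTriangular fun n : ℕ+ => τ n := isTriangular_iff.2 fun n => by
    refine ⟨hτ₀ n, fun i hin => ?_⟩
    rw [dt_apply, hτ]
    rcases hin.eq_or_lt with rfl | hlt
    · rw [(hlead i).1, dt_X_self]
    · have hdeg : (p i).natDegree < n := (hlead i).2.trans_lt hlt
      rw [coeff_eq_zero_of_natDegree_lt hdeg, dt_X_of_ne hlt.ne']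
  obtain ⟨c, hc⟩ := hτtri.exists_timeChange
  refine ⟨c, τ 0, fun n => ?_⟩
  rw [← (hB n).plus_eq, plus_eq_plus_of_sub_mem (hp n), plus_aeval (hlead n).2,
    sum_range_succ_eq_sum_Icc_one_add, hc, pow_zero, plus_one]
  simp only [dt_apply, hτ]

end LaxOperators

theorem mainTheorem3_general {A : Type*} [CommRing A] [Algebra ℚ A]
    (B : ℕ+ → BandMat (TimeSeries A))
    (hB : ∀ n : ℕ+, (B n).IsMonicUpper n)
    (hZS : ∀ m n : ℕ+, matDt n (B m) - matDt m (B n) + ⁅B m, B n⁆ = 0) :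
    (∃ L : BandMat (TimeSeries A), L.IsLaxForm ∧ ∀ n : ℕ+, matDt n L = ⁅B n, L⁆) ∧
    ∀ L : BandMat (TimeSeries A), L.IsLaxForm → (∀ n : ℕ+, matDt n L = ⁅B n, L⁆) →
      ∃ (c : TimeChange A) (f₀ : TimeSeries A),
        (∀ n : ℕ+, L.mapEntries (c.dtNew n) = ⁅(L ^ (n : ℕ)).plus, L⁆) ∧
        IsMKPLax (L.mapEntries c.toNew) ∧
        ∀ n : ℕ+, B n =
          ∑ k ∈ Finset.Icc 1 n, dt n (c.new k) • (L ^ (k : ℕ)).plus +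
            dt n f₀ • (1 : BandMat (TimeSeries A)) := by
  refine ⟨exists_isLaxForm_of_zakharovShabat (fun n => (hB n).isMonic) hZS, fun L hL hLax => ?_⟩
  obtain ⟨c, f₀, hBsum⟩ := exists_timeChange_eq_sum_plus hB hZS hL hLax
  have hLaxNew := c.mapEntries_dtNew_eq_lie hLax hBsum
  exact ⟨c, f₀, hLaxNew, c.isMKPLax hL hLaxNew, hBsum⟩

theorem mainTheorem3 {A : Type*} [CommRing A] [Algebra ℂ A]
    (B : ℕ+ → BandMat (TimeSeries A))
    (hB : ∀ n : ℕ+, (B n).IsMonicUpper n)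
    (hZS : ∀ m n : ℕ+, matDt n (B m) - matDt m (B n) + ⁅B m, B n⁆ = 0) :
    (∃ L : BandMat (TimeSeries A), L.IsLaxForm ∧ ∀ n : ℕ+, matDt n L = ⁅B n, L⁆) ∧
    ∀ L : BandMat (TimeSeries A), L.IsLaxForm → (∀ n : ℕ+, matDt n L = ⁅B n, L⁆) →
      ∃ (c : TimeChange A) (f₀ : TimeSeries A),
        (∀ n : ℕ+, L.mapEntries (c.dtNew n) = ⁅(L ^ (n : ℕ)).plus, L⁆) ∧
        IsMKPLax (L.mapEntries c.toNew) ∧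
        ∀ n : ℕ+, B n =
          ∑ k ∈ Finset.Icc 1 n, dt n (c.new k) • (L ^ (k : ℕ)).plus +
            dt n f₀ • (1 : BandMat (TimeSeries A)) :=
  let _ : Algebra ℚ A := Algebra.compHom A (algebraMap ℚ ℂ)
  mainTheorem3_general B hB hZS
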